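/- Let $G$ be a finite connected multigraph without loop edges, with vertex set $V(G)$ and edge set $E(G)$, equipped with a ribbon structure, i.e. a cyclic ordering of the edges around each vertex. Assume that $G$ is planar as a ribbon graph: the closed oriented surface obtained by thickening $G$ to an oriented surface with boundary and gluing a disk to each boundary component has genus $0$ (equivalently $\#V(G)-\#E(G)+\#\{\text{boundary components}\}=2$). Notation. Divisors are elements of the free abelian group on $V(G)$; two divisors are linearly equivalent if they differ by $\Delta f=\sum_{v}\big(\sum_{e=vw}(f(v)-f(w))\big)(v)$ for some $f:V(G)\to\mathbb Z$; $[D]$ is the class of $D$; $\operatorname{Pic}^k(G)$ is the set of classes of divisors of degree $k$, and $\operatorname{Pic}^0(G)$ is a group. Put $g=\#E(G)-\#V(G)+1$, let $S(G)$ be the set of spanning trees, and let $B(G)$ be the set of break divisors, i.e. divisors obtained from some $T\in S(G)$ by dropping a chip at one endpoint of each of the $g$ edges outside $T$. For a vertex $v$, an edge $e$ adjacent to $v$ and $T\in S(G)$, the Bernardi tour starts at $v$ facing $e$. At each step, if the edge faced is in $T$ one walks along it and then faces the next edge, in the cyclic ordering around the new vertex, after the edge just walked; if it is not in $T$ one cuts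 through it, stays at the vertex, and faces the next edge there. The divisor $\beta_{(v,e)}(T)$ is the sum, over the edges $e'\notin T$, of the vertex from which the tour first cuts through $e'$. Theorem. (i) For every vertex $v$ and every edge $e$ adjacent to $v$, $\beta_{(v,e)}$ is a bijection $S(G)\to B(G)$, and every class in $\operatorname{Pic}^g(G)$ contains exactly one break divisor. Hence, for $\gamma\in\operatorname{Pic}^0(G)$, a map $S(G)\to S(G)$ is well defined by $\gamma\cdot T=\beta_{(v,e)}^{-1}\big(\gamma\cdot\beta_{(v,e)}(T)\big)$, where, for $D\in B(G)$, $\gamma\cdot D$ is the unique break divisor in the class $\gamma+[D]$. (ii) The map $\beta_v:(\gamma,T)\mapsto\gamma\cdot T$ depends neither on the edge $e$ adjacent to $v$ nor on the vertex $v$. (iii) $S(G)$ is nonempty, and there is exactly one simply transitive action of $\operatorname{Pic}^0(G)$ on $S(G)$ that agrees with $\beta_v$ for all $v$ having an adjacent edge. -/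

import Mathlib

/-- A finite connected multigraph without loops, with vertex set `V` and edge set `E`
(parallel edges are allowed).  `D` is the set of directed edges: a directed edge `d` leaves the
vertex `src d`, has underlying edge `edge d` and opposite `rev d`, and every edge underlies
exactly two directed edges, which are opposite to each other.  As there are no loops, the
directed edge `d` is the same thing as the pair (`src d`, `edge d`) of a vertex and an edge
adjacent to it. (Finiteness is imposed through the types.) -/
structure LooplessMultigraph (V E D : Type*) where
  src : D → V
  edge : D → E
  rev : D → D
  rev_rev : ∀ d, rev (rev d) = d
  rev_ne : ∀ d, rev d ≠ d
  edge_surjective : Function.Surjective edge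
  edge_eq_iff : ∀ d d', edge d = edge d' ↔ d' = d ∨ d' = rev d
  loopless : ∀ d, src (rev d) ≠ src d
  nonempty : Nonempty V
  connected : ∀ u w : V, Relation.ReflTransGen (fun x y => ∃ d, src d = x ∧ src (rev d) = y) u w

/-- A ribbon graph: a graph with a cyclic ordering of the edges around each vertex.  The
permutation `next` sends a directed edge `d` to the directed edge which follows it in the cyclic
ordering around its source, and it permutes the directed edges leaving a given vertex in a single
cycle. -/
structure RibbonGraph (V E D : Type*) extends LooplessMultigraph V E D where
  next : Equiv.Perm D
  src_next : ∀ d, src (next d) = src d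
  next_cyclic : ∀ d d', src d = src d' → next.SameCycle d d'

namespace LooplessMultigraph

variable {V E D : Type*} (G : LooplessMultigraph V E D)

/-- The target of a directed edge. -/
def tgt (d : D) : V := G.src (G.rev d)

/-- The set of edges `T`, viewed as a spanning subgraph with vertex set `V`, is connected. -/
def ConnectedBy (T : Set E) : Prop :=
  ∀ u w : V, Relation.ReflTransGen (fun x y => ∃ d, G.edge d ∈ T ∧ G.src d = x ∧ G.tgt d = y) u w

/-- The set of edges `T` contains a simple cycle: directed edges `c 0, …, c n`, each ending where
the next one starts (cyclically), with distinct vertices and distinct underlying edges in `T`. -/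
def HasCycle (T : Set E) : Prop :=
  ∃ (n : ℕ) (c : Fin (n + 1) → D), (∀ i, G.edge (c i) ∈ T) ∧ (∀ i, G.tgt (c i) = G.src (c (i + 1))) ∧
    Function.Injective (fun i => G.src (c i)) ∧ Function.Injective (fun i => G.edge (c i))

/-- The set `S(G)` of spanning trees of `G`, a spanning tree being given by its edge set. -/
def SpanningTree : Type _ := {T : Set E // G.ConnectedBy T ∧ ¬ G.HasCycle T}

/-- The vertex `v` is an endpoint of the edge `e`. -/
def IsEndpoint (v : V) (e : E) : Prop := ∃ d, G.edge d = e ∧ G.src d = v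

section Divisors

variable [Fintype V] [Fintype E] [Fintype D]

/-- The degree of a divisor.  Divisors are elements of the free abelian group on `V`, that is,
functions `V → ℤ`. -/
def degree : (V → ℤ) →+ ℤ where
  toFun F := ∑ v, F v
  map_zero' := by simp
  map_add' F F' := by simp [Finset.sum_add_distrib]

open Classical in
/-- The Laplacian: `(Δ f)(v) = ∑ (f v - f w)`, over all edges `vw` adjacent to `v`. -/
noncomputable def laplacian : (V → ℤ) →+ (V → ℤ) where
  toFun f v := ∑ d with G.src d = v, (f v - f (G.tgt d))
  map_zero' := by ext; simp
  map_add' f f' := by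
    ext v
    simp only [Pi.add_apply, ← Finset.sum_add_distrib]
    exact Finset.sum_congr rfl fun _ _ => by ring

/-- The group `Prin(G)` of principal divisors. -/
noncomputable def Prin : AddSubgroup (V → ℤ) := G.laplacian.range

/-- The group `Pic(G)` of divisors of arbitrary degree modulo linear equivalence. -/
abbrev Pic : Type _ := (V → ℤ) ⧸ G.Prin

/-- The linear equivalence class `[F]` of a divisor `F`. -/
noncomputable def cls (F : V → ℤ) : G.Pic := QuotientAddGroup.mk F

/-- The set `Pic^k(G)` of linear equivalence classes of divisors of degree `k`. -/
def PicDeg (k : ℤ) : Set G.Pic := {c | ∃ F : V → ℤ, degree F = k ∧ G.cls F = c}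

/-- The group `Pic^0(G)` of linear equivalence classes of divisors of degree `0`. -/
noncomputable def Pic0 : AddSubgroup G.Pic := (degree (V := V)).ker.map (QuotientAddGroup.mk' G.Prin)

/-- The combinatorial genus `g = #E - #V + 1`. -/
def genus (_G : LooplessMultigraph V E D) : ℤ := Fintype.card E - Fintype.card V + 1

open Classical in
/-- The divisor obtained by dropping, for every edge `e` outside `T`, a chip at `c e`. -/
noncomputable def chipDivisor (_G : LooplessMultigraph V E D) (T : Set E) (c : E → V) : V → ℤ :=
  ∑ e with e ∉ T, Pi.single (c e) 1

/-- The set `B(G)` of break divisors: divisors obtained from some spanning tree `T` by dropping a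
chip at one of the endpoints of each edge outside `T`. -/
def breakDivisors : Set (V → ℤ) :=
  {F | ∃ (T : G.SpanningTree) (c : E → V), (∀ e ∉ T.1, G.IsEndpoint (c e) e) ∧
    F = G.chipDivisor T.1 c}

open Classical in
/-- The translate `γ · F` for a class `γ` in `Pic^0(G)` and a break divisor `F`: the break divisor
in the linear equivalence class `γ + [F]` (with value `F` if there were none). -/
noncomputable def translate (γ : G.Pic0) (F : V → ℤ) : V → ℤ :=
  if h : ∃ F' ∈ G.breakDivisors, G.cls F' = (γ : G.Pic) + G.cls F then h.choose else F

end Divisors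

end LooplessMultigraph

namespace RibbonGraph

open LooplessMultigraph

variable {V E D : Type*} (G : RibbonGraph V E D)

/-- The boundary components of the oriented surface with boundary obtained by thickening `G`.
Walking along the boundary, after the directed edge `d` one follows the directed edge after the
opposite of `d` in the cyclic ordering around the target of `d`; in addition, a vertex without
edges thickens to a disk, which has one boundary component. -/
def BoundaryComponent : Type _ :=
  Quot (fun d d' : D => d' = G.next (G.rev d)) ⊕ {v : V // ∀ d, G.src d ≠ v}

/-- The Euler characteristic of the closed oriented surface obtained from the thickening of `G` by
gluing a disk to every boundary component. -/
noncomputable def eulerChar : ℤ :=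
  (Nat.card V : ℤ) - Nat.card E + Nat.card G.BoundaryComponent

/-- The closed connected oriented surface attached to `G` has genus `k`, that is, Euler
characteristic `2 - 2k`. -/
def HasTopologicalGenus (k : ℕ) : Prop := G.eulerChar = 2 - 2 * (k : ℤ)

/-- A ribbon graph is planar if its topological genus is `0`. -/
def IsPlanar : Prop := G.HasTopologicalGenus 0

open Classical in
/-- One step of the tour around `T`, standing at the source of `d` and facing `d`.  If the edge of
`d` belongs to `T`, walk along it and turn to the following edge around the new vertex; otherwise
cut through it and turn to the following edge around the same vertex. -/
noncomputable def tourStep (T : Set E) (d : D) : D :=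
  if G.edge d ∈ T then G.next (G.rev d) else G.next d

/-- The directed edge faced at time `n` of the tour around `T` with initial data the vertex `src d`
and the edge `edge d`. -/
noncomputable def tour (d : D) (T : Set E) (n : ℕ) : D := (G.tourStep T)^[n] d

/-- The vertex at which the tour around `T` first meets the edge `e`; for `e` outside `T`, this is
the vertex from which the tour first cuts through `e`. -/
noncomputable def firstVertex (d : D) (T : Set E) (e : E) : V :=
  G.src (G.tour d T (sInf {n | G.edge (G.tour d T n) = e}))

variable [Fintype V] [Fintype E] [Fintype D]

/-- The Bernardi map `β_(v,e)` for the vertex `v = src d` and the edge `e = edge d`: drop a chip at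
the current vertex each time the tour first cuts through an edge outside `T`. -/
noncomputable def bernardi (d : D) (T : G.SpanningTree) : V → ℤ :=
  G.chipDivisor T.1 (G.firstVertex d T.1)

open Classical in
/-- The Bernardi action `γ · T = β⁻¹(γ · β(T))`, where `β = β_(v,e)` for the vertex `v = src d` and
the edge `e = edge d` (with value `T` if there were no preimage). -/
noncomputable def bernardiAct (d : D) (γ : G.Pic0) (T : G.SpanningTree) : G.SpanningTree :=
  if h : ∃ T', G.bernardi d T' = G.translate γ (G.bernardi d T) then h.choose else T

end RibbonGraph

set_option linter.unusedSectionVars false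

/-! ### Paths, cycles and edge counts of trees. -/

namespace LooplessMultigraph

variable {V E D : Type*} (G : LooplessMultigraph V E D)

/-! Write e(A) for the number of edges inside a vertex set A. Break divisors are handled through
inequalities: degree g, and F(A) ≥ e(A) - #A + 1 for every nonempty A (`IsBreakMod ∅ ∅`). A break
divisor satisfies them because a tree has at most #A - 1 edges inside A. A maximum principle shows
that a class contains at most one solution, and minimizing a quadratic energy shows that every class
of degree g contains one.

Two facts make the Bernardi map a bijection. It is injective: where two tours first part, one tree
determines a fundamental cut, and the two divisors have different degrees on one side of it
(`bernardi_ne`). A deletion-contraction induction shows that there are at most as many solutions of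
the inequalities as spanning trees (`card_le_card_spanningTree`). So every solution is a Bernardi
divisor, hence a break divisor.

For independence of the initial data it suffices that the class of β_d(T) changes by an amount
independent of T when d changes. Turning d to the next edge at its vertex adds the class of the
boundary of d, on any ribbon graph (`cls_bernardi_next`). On a planar graph, following a boundary
component leaves the divisor itself unchanged (`IsPlanar.bernardi_next_rev`): Euler's formula forces
every edge added to a tree to split a boundary component, so the non-tree edges do not cross along
the tour and their contributions cancel in pairs. These two moves connect all initial data. The
action is then the translation action of Pic^0 on Pic^g, transported by a bijection. -/

theorem edge_rev (d : D) : G.edge (G.rev d) = G.edge d :=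
  ((G.edge_eq_iff d (G.rev d)).2 (Or.inr rfl)).symm

theorem src_rev (d : D) : G.src (G.rev d) = G.tgt d := rfl

theorem tgt_rev (d : D) : G.tgt (G.rev d) = G.src d := by rw [tgt, G.rev_rev]

theorem tgt_ne_src (d : D) : G.tgt d ≠ G.src d := G.loopless d

/-- Two vertices are joined by a path with edges in `T`. -/
def Conn (T : Set E) : V → V → Prop :=
  Relation.ReflTransGen (fun x y => ∃ d, G.edge d ∈ T ∧ G.src d = x ∧ G.tgt d = y)

variable {G}

theorem Conn.refl (T : Set E) (v : V) : G.Conn T v v := Relation.ReflTransGen.refl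

theorem Conn.trans {T : Set E} {u v w : V} (h : G.Conn T u v) (h' : G.Conn T v w) :
    G.Conn T u w := Relation.ReflTransGen.trans h h'

theorem Conn.dart {T : Set E} {d : D} (h : G.edge d ∈ T) : G.Conn T (G.src d) (G.tgt d) :=
  Relation.ReflTransGen.single ⟨d, h, rfl, rfl⟩

theorem Conn.symm {T : Set E} {u v : V} (h : G.Conn T u v) : G.Conn T v u := by
  induction h with
  | refl => exact Conn.refl _ _
  | tail _ h2 ih =>
    obtain ⟨d, hd, rfl, rfl⟩ := h2
    have := Conn.dart (G := G) (d := G.rev d) (T := T) (by rwa [G.edge_rev])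
    rw [G.src_rev, G.tgt_rev] at this
    exact this.trans ih

theorem Conn.mem_of_closed {T : Set E} {P : V → Prop}
    (hP : ∀ d, G.edge d ∈ T → P (G.src d) → P (G.tgt d)) {u v : V} (h : G.Conn T u v)
    (hu : P u) : P v := by
  induction h with
  | refl => exact hu
  | tail _ h2 ih =>
    obtain ⟨d, hd, rfl, rfl⟩ := h2
    exact hP d hd ih

/-- A chain between two related points can be chosen without repetitions. -/
theorem exists_injective_chain {α : Type*} {r : α → α → Prop} {a b : α}
    (h : Relation.ReflTransGen r a b) :
    ∃ (n : ℕ) (p : ℕ → α), p 0 = a ∧ p n = b ∧ (∀ i < n, r (p i) (p (i + 1))) ∧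
      ∀ i ≤ n, ∀ j ≤ n, p i = p j → i = j := by
  classical
  have hex : ∃ (n : ℕ) (p : ℕ → α), p 0 = a ∧ p n = b ∧ ∀ i < n, r (p i) (p (i + 1)) := by
    induction h with
    | refl => exact ⟨0, fun _ => a, rfl, rfl, by simp⟩
    | @tail y z _ hr ih =>
      obtain ⟨n, p, h0, hn, hp⟩ := ih
      refine ⟨n + 1, fun i => if i ≤ n then p i else z, by simp [h0], by simp, fun i hi => ?_⟩
      rcases Nat.lt_or_ge i n with h | h
      · simpa [h.le, Nat.succ_le_of_lt h] using hp i h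
      · obtain rfl : i = n := by omega
        simpa [hn] using hr
  obtain ⟨p, h0, hn, hp⟩ := Nat.find_spec hex
  have hmin := fun m hm => Nat.find_min hex (m := m) hm
  set n := Nat.find hex
  have key : ∀ i j, i < j → j ≤ n → p i ≠ p j := by
    intro i j hij hj he
    -- Cutting out the loop between i and j would give a shorter chain.
    refine hmin (n - (j - i)) (by omega)
      ⟨fun k => if k ≤ i then p k else p (k + (j - i)), by simp [h0], ?_, fun k hk => ?_⟩
    · by_cases h : n - (j - i) ≤ i
      · have h1 : n = j := by omega
        have h2 : n - (j - i) = i := by omega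
        simp only [h2, le_refl, if_true]
        rw [he, ← h1, hn]
      · simp only [h, if_false]
        rw [← hn]; congr 1; omega
    · rcases Nat.lt_trichotomy k i with h | h | h
      · simpa [h.le, Nat.succ_le_of_lt h] using hp k (by omega)
      · subst h
        have : k + 1 + (j - k) = j + 1 := by omega
        simpa [this, he] using hp j (by omega)
      · have h1 : ¬ k ≤ i := by omega
        have h2 : ¬ k + 1 ≤ i := by omega
        have h3 : k + 1 + (j - i) = k + (j - i) + 1 := by omega
        simpa [h1, h2, h3] using hp (k + (j - i)) (by omega)
  refine ⟨n, p, h0, hn, hp, fun i hi j hj he => ?_⟩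
  rcases Nat.lt_trichotomy i j with h | h | h
  · exact absurd he (key i j h hj)
  · exact h
  · exact absurd he.symm (key j i h hi)

/-- In an acyclic set of edges, removing an edge disconnects its endpoints. -/
theorem not_conn_diff_of_not_hasCycle {T : Set E} (hT : ¬ G.HasCycle T) {d : D}
    (hd : G.edge d ∈ T) : ¬ G.Conn (T \ {G.edge d}) (G.src d) (G.tgt d) := by
  classical
  intro hc
  obtain ⟨n, p, h0, hn, hp, hinj⟩ := exists_injective_chain hc.symm
  have : Nonempty D := ⟨d⟩
  choose! δ hδ using hp
  have key : ∀ i j, i < j → j ≤ n →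
      G.edge (if i < n then δ i else d) ≠ G.edge (if j < n then δ j else d) := by
    intro i j hij hj he
    have hi : i < n := by omega
    rw [if_pos hi] at he
    rcases hj.lt_or_eq with hj' | rfl
    · rw [if_pos hj', G.edge_eq_iff] at he
      rcases he with he | he
      · have := hinj i hi.le j hj (by rw [← (hδ i hi).2.1, ← (hδ j hj').2.1, he])
        omega
      · have := hinj i hi.le (j + 1) hj' (by
          rw [← (hδ i hi).2.1, ← (hδ j hj').2.2, he, G.tgt_rev])
        omega
    · simp only [lt_irrefl, if_false] at he
      exact (hδ i hi).1.2 he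
  -- The path runs from the target of d to its source; d itself, at index n, closes it up to a
  -- simple cycle.
  refine hT ⟨n, fun i => if i.1 < n then δ i else d, fun i => ?_, fun i => ?_, fun i j h => ?_,
    fun i j h => ?_⟩
  · dsimp only
    split_ifs with h
    · exact (hδ _ h).1.1
    · exact hd
  · have hs : ∀ j : Fin (n + 1), G.src (if j.1 < n then δ j else d) = p j := by
      intro j
      split_ifs with h
      · exact (hδ _ h).2.1
      · rw [show j.1 = n by omega, hn]
    rw [hs]
    dsimp only
    split_ifs with h
    · rw [(hδ _ h).2.2, Fin.val_add_one_of_lt (show i < Fin.last n from h)]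
    · rw [show i = Fin.last n from Fin.ext (by simp; omega), Fin.last_add_one, Fin.val_zero, h0]
  · have hs : ∀ j : Fin (n + 1), G.src (if j.1 < n then δ j else d) = p j := by
      intro j
      split_ifs with h
      · exact (hδ _ h).2.1
      · rw [show j.1 = n by omega, hn]
    dsimp only at h
    rw [hs, hs] at h
    exact Fin.ext (hinj _ (by omega) _ (by omega) h)
  · rcases lt_trichotomy i j with hij | hij | hij
    · exact absurd h (key i j hij (by omega))
    · exact hij
    · exact absurd h.symm (key j i hij (by omega))

open scoped Fin.CommRing in
/-- Adding an edge between two components of an acyclic set keeps it acyclic. -/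
theorem not_hasCycle_insert {K : Set E} (hK : ¬ G.HasCycle K) {d : D}
    (hd : ¬ G.Conn K (G.src d) (G.tgt d)) : ¬ G.HasCycle (insert (G.edge d) K) := by
  rintro ⟨n, c, hc, ht, hs, he⟩
  by_cases hall : ∀ i, G.edge (c i) ∈ K
  · exact hK ⟨n, c, hall, ht, hs, he⟩
  push Not at hall
  obtain ⟨i, hi⟩ := hall
  have hid : G.edge (c i) = G.edge d := (hc i).resolve_right hi
  have hother : ∀ j, j ≠ i → G.edge (c j) ∈ K := fun j hj =>
    (hc j).resolve_left fun h => hj (he (h.trans hid.symm))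
  -- Going round the cycle from just after the new edge, at index i, back to it uses only edges of K
  -- and so joins the endpoints of d in K.
  have hpath : ∀ k : ℕ, k ≤ n →
      G.Conn K (G.src (c (i + 1))) (G.src (c (i + 1 + (k : Fin (n + 1))))) := by
    intro k
    induction k with
    | zero => intro _; simpa using Conn.refl _ _
    | succ k ih =>
      intro hk
      refine (ih (by omega)).trans ?_
      have := Conn.dart (hother (i + 1 + (k : Fin (n + 1))) ?_)
      · rw [ht] at this
        convert this using 3
        push_cast; ring
      · intro h
        have h2 : ((k + 1 : ℕ) : Fin (n + 1)) = 0 := by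
          have : i + ((k + 1 : ℕ) : Fin (n + 1)) = i := by
            rw [← h]; push_cast; nth_rewrite 2 [← h]; ring
          simpa using this
        rw [Fin.natCast_eq_zero] at h2
        exact absurd (Nat.le_of_dvd (by omega) h2) (by omega)
  have hfin := hpath n le_rfl
  have hlast : i + 1 + ((n : ℕ) : Fin (n + 1)) = i := by
    have : ((n + 1 : ℕ) : Fin (n + 1)) = 0 := by simp
    push_cast at this
    rw [add_assoc, add_comm 1, this, add_zero]
  rw [hlast, ← ht] at hfin
  rcases (G.edge_eq_iff _ _).1 hid with h | h
  · rw [h] at hd; exact hd hfin.symm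
  · rw [h, G.src_rev, G.tgt_rev] at hd; exact hd hfin

section Finite

variable [Fintype E]

open Classical in
/-- The edges with both endpoints in `A`. -/
noncomputable def inner (G : LooplessMultigraph V E D) (A : Finset V) : Finset E :=
  {e | ∀ d, G.edge d = e → G.src d ∈ A}

theorem edge_mem_inner {A : Finset V} {d : D} :
    G.edge d ∈ G.inner A ↔ G.src d ∈ A ∧ G.tgt d ∈ A := by
  simp only [inner, Finset.mem_filter, Finset.mem_univ, true_and]
  constructor
  · intro h
    exact ⟨h d rfl, h (G.rev d) (G.edge_rev d)⟩
  · rintro ⟨h1, h2⟩ d' hd'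
    rcases (G.edge_eq_iff _ _).1 hd' with h | h
    · rwa [← h]
    · rwa [h, tgt_rev] at h2

open Classical in
/-- An acyclic set has at most `#A - 1` edges inside a nonempty set `A` of vertices. -/
theorem card_inner_add_one_le {T : Finset E} (hT : ¬ G.HasCycle (T : Set E)) (A : Finset V)
    (hA : A.Nonempty) : (G.inner A ∩ T).card + 1 ≤ A.card := by
  induction A using Finset.strongInduction with
  | H A ih =>
    rcases (G.inner A ∩ T).eq_empty_or_nonempty with h | ⟨e, he⟩
    · rw [h]; simpa using hA
    obtain ⟨d, rfl⟩ := G.edge_surjective e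
    rw [Finset.mem_inter, edge_mem_inner] at he
    obtain ⟨⟨hs, ht⟩, heT⟩ := he
    have hnc := not_conn_diff_of_not_hasCycle hT (d := d) heT
    -- Deleting a tree edge inside A splits A into two nonempty parts. Every other tree edge inside
    -- A lies in one part, so the two inductive bounds add up.
    set A1 := A.filter fun v => G.Conn ((T : Set E) \ {G.edge d}) (G.src d) v with hA1
    set A2 := A.filter fun v => ¬ G.Conn ((T : Set E) \ {G.edge d}) (G.src d) v with hA2
    have hs1 : G.src d ∈ A1 := by simp [hA1, hs, Conn.refl]
    have ht2 : G.tgt d ∈ A2 := by simp [hA2, ht, hnc]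
    have h1 := ih A1 ⟨Finset.filter_subset _ _, fun h => by
      have := h ht; simp [hA1, hnc] at this⟩ ⟨_, hs1⟩
    have h2 := ih A2 ⟨Finset.filter_subset _ _, fun h => by
      have := h hs; simp [hA2, Conn.refl] at this⟩ ⟨_, ht2⟩
    have hcard : A1.card + A2.card = A.card := Finset.card_filter_add_card_filter_not _
    have hsub : G.inner A ∩ T ⊆ insert (G.edge d) ((G.inner A1 ∩ T) ∪ (G.inner A2 ∩ T)) := by
      intro e he
      obtain ⟨y, rfl⟩ := G.edge_surjective e
      rw [Finset.mem_inter, edge_mem_inner] at he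
      obtain ⟨⟨hys, hyt⟩, hyT⟩ := he
      simp only [Finset.mem_insert, Finset.mem_union, Finset.mem_inter, edge_mem_inner, hyT,
        and_true, hA1, hA2, Finset.mem_filter, hys, hyt, true_and]
      by_cases hyd : G.edge y = G.edge d
      · exact Or.inl hyd
      · right
        have hyc : G.Conn ((T : Set E) \ {G.edge d}) (G.src y) (G.tgt y) :=
          Conn.dart ⟨hyT, hyd⟩
        by_cases hc : G.Conn ((T : Set E) \ {G.edge d}) (G.src d) (G.src y)
        · exact Or.inl ⟨hc, hc.trans hyc⟩
        · exact Or.inr ⟨hc, fun h => hc (h.trans hyc.symm)⟩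
    have := Finset.card_le_card hsub
    have := Finset.card_insert_le (G.edge d) ((G.inner A1 ∩ T) ∪ (G.inner A2 ∩ T))
    have := Finset.card_union_le (G.inner A1 ∩ T) (G.inner A2 ∩ T)
    omega

variable [Fintype V]

-- Merging parallel edges gives a connected simple graph on V with no more edges than T, to which
-- the usual bound applies.
open Classical in
theorem card_vert_le_of_connectedBy {T : Finset E} (hT : G.ConnectedBy (T : Set E)) :
    Fintype.card V ≤ T.card + 1 := by
  let H : SimpleGraph V :=
    { Adj := fun x y => ∃ d, G.edge d ∈ T ∧ G.src d = x ∧ G.tgt d = y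
      symm := ⟨by
        rintro x y ⟨d, hd, rfl, rfl⟩
        exact ⟨G.rev d, by rwa [G.edge_rev], G.src_rev d, G.tgt_rev d⟩⟩
      loopless := ⟨by
        rintro x ⟨d, hd, rfl, h⟩
        exact G.tgt_ne_src d h⟩ }
  have hH : H.Connected := by
    have := G.nonempty
    refine ⟨fun u w => ?_⟩
    have := hT u w
    rw [SimpleGraph.reachable_iff_reflTransGen]
    exact this
  have h1 := hH.card_vert_le_card_edgeSet_add_one
  choose δ hδ using G.edge_surjective
  have h2 : Nat.card H.edgeSet ≤ T.card := by
    have hex : ∀ e ∈ T, s(G.src (δ e), G.tgt (δ e)) ∈ H.edgeSet := fun e he =>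
      ⟨δ e, by rwa [hδ], rfl, rfl⟩
    have : Function.Surjective
        (fun e : T => (⟨s(G.src (δ e), G.tgt (δ e)), hex e e.2⟩ : H.edgeSet)) := by
      rintro ⟨s, hs⟩
      induction s with
      | _ x y =>
      obtain ⟨d, hd, hx, hy⟩ := hs
      dsimp only at hx hy
      subst hx hy
      refine ⟨⟨G.edge d, hd⟩, Subtype.ext ?_⟩
      dsimp only
      rcases (G.edge_eq_iff _ _).1 (hδ (G.edge d)) with h | h
      · rw [← h]
      · nth_rewrite 3 4 [h]
        rw [G.src_rev, G.tgt_rev, Sym2.eq_swap]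
    have := Nat.card_le_card_of_surjective _ this
    simpa using this
  rw [Nat.card_eq_fintype_card] at h1
  omega

theorem inner_univ : G.inner Finset.univ = Finset.univ := by
  ext e; simp [inner]

open Classical in
theorem card_add_one_of_spanning {T : Finset E} (hc : G.ConnectedBy (T : Set E))
    (ha : ¬ G.HasCycle (T : Set E)) : T.card + 1 = Fintype.card V := by
  have := G.nonempty
  have h1 := card_vert_le_of_connectedBy hc
  have h2 := card_inner_add_one_le ha Finset.univ Finset.univ_nonempty
  rw [inner_univ, Finset.univ_inter, Finset.card_univ] at h2
  omega

end Finite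

end LooplessMultigraph

/-! ### The inequalities of break divisors. -/

namespace LooplessMultigraph

variable {V E D : Type*} {G : LooplessMultigraph V E D}

/-- The fixed-point-free involution reversing directed edges. -/
def revEquiv (G : LooplessMultigraph V E D) : D ≃ D := ⟨G.rev, G.rev, G.rev_rev, G.rev_rev⟩

theorem sum_rev [Fintype D] {M : Type*} [AddCommMonoid M] (g : D → M) :
    ∑ d, g (G.rev d) = ∑ d, g d :=
  Equiv.sum_comp G.revEquiv g

open Classical in
theorem card_darts [Fintype D] (S : Finset E) :
    (Finset.univ.filter fun d => G.edge d ∈ S).card = 2 * S.card := by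
  rw [Finset.card_eq_sum_card_fiberwise (f := G.edge) (t := S) (by intro d; simp), mul_comm,
    Finset.sum_const_nat]
  intro e he
  obtain ⟨d, rfl⟩ := G.edge_surjective e
  rw [Finset.card_eq_two]
  refine ⟨d, G.rev d, (G.rev_ne d).symm, ?_⟩
  ext d'
  simp only [Finset.mem_filter, Finset.mem_univ, true_and, Finset.mem_insert,
    Finset.mem_singleton]
  rw [eq_comm (a := G.edge d'), G.edge_eq_iff]
  constructor
  · exact fun h => h.2
  · intro h
    refine ⟨?_, h⟩
    rcases h with rfl | rfl
    · exact he
    · rwa [G.edge_rev]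

instance [Finite E] : Finite G.SpanningTree :=
  inferInstanceAs (Finite {T : Set E // G.ConnectedBy T ∧ ¬ G.HasCycle T})

/-- The set `A` of vertices is a union of connected components of `(V, K)`. -/
def Saturated (G : LooplessMultigraph V E D) (K : Set E) (A : Finset V) : Prop :=
  ∀ d, G.edge d ∈ K → G.src d ∈ A → G.tgt d ∈ A

theorem Saturated.mem_iff {K : Set E} {A : Finset V} (h : G.Saturated K A) {d : D}
    (hd : G.edge d ∈ K) : G.src d ∈ A ↔ G.tgt d ∈ A := by
  refine ⟨h d hd, fun ht => ?_⟩
  have := h (G.rev d) (by rwa [G.edge_rev]) ht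
  rwa [G.tgt_rev] at this

theorem Saturated.mem_iff_of_conn {K : Set E} {A : Finset V} (h : G.Saturated K A) {u v : V}
    (hc : G.Conn K u v) : u ∈ A ↔ v ∈ A :=
  ⟨fun hu => hc.mem_of_closed (P := (· ∈ A)) h hu,
    fun hv => hc.symm.mem_of_closed (P := (· ∈ A)) h hv⟩

section

variable [Fintype V] [Fintype E]

open Classical in
/-- The inequalities characterizing break divisors of the graph obtained by deleting `C` and
contracting `K`. -/
structure IsBreakMod (G : LooplessMultigraph V E D) (K C : Finset E) (F : V → ℤ) : Prop where
  le_sum : ∀ A : Finset V, A.Nonempty → G.Saturated K A →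
    ((G.inner A \ C).card : ℤ) - A.card + 1 ≤ ∑ v ∈ A, F v
  sum_eq : ∑ v, F v = ((Finset.univ \ C).card : ℤ) - Fintype.card V + 1

open Classical in
theorem sum_chipDivisor [Fintype D] (T : Set E) (c : E → V) (A : Finset V) :
    ∑ v ∈ A, G.chipDivisor T c v =
      ((Finset.univ.filter fun e => e ∉ T ∧ c e ∈ A).card : ℤ) := by
  simp only [chipDivisor, Finset.sum_apply]
  rw [Finset.sum_comm, ← Finset.filter_filter, Finset.card_filter]
  push_cast
  refine Finset.sum_congr rfl fun e _ => ?_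
  simp [Pi.single_apply]

open Classical in
theorem SpanningTree.card_add_one (T : G.SpanningTree) :
    T.1.toFinset.card + 1 = Fintype.card V :=
  card_add_one_of_spanning (by simpa using T.2.1) (by simpa using T.2.2)

open Classical in
theorem SpanningTree.card_inner_add_one_le (T : G.SpanningTree) (A : Finset V)
    (hA : A.Nonempty) : (G.inner A ∩ T.1.toFinset).card + 1 ≤ A.card :=
  LooplessMultigraph.card_inner_add_one_le (by simpa using T.2.2) A hA

theorem mem_of_isEndpoint {A : Finset V} {e : E} (he : e ∈ G.inner A) {v : V}
    (hv : G.IsEndpoint v e) : v ∈ A := by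
  obtain ⟨d, rfl, rfl⟩ := hv
  exact (edge_mem_inner.1 he).1

/-- Every non-tree edge inside A drops its chip in A, and at most #A - 1 of the edges inside A
belong to the tree. -/
theorem isBreakMod_of_mem_breakDivisors [Fintype D] {F : V → ℤ} (hF : F ∈ G.breakDivisors) :
    G.IsBreakMod ∅ ∅ F := by
  classical
  obtain ⟨T, c, hc, rfl⟩ := hF
  constructor
  · intro A hA _
    rw [sum_chipDivisor]
    have h1 := T.card_inner_add_one_le A hA
    have h2 : (G.inner A \ T.1.toFinset).card ≤
        (Finset.univ.filter fun e => e ∉ T.1 ∧ c e ∈ A).card := by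
      refine Finset.card_le_card fun e he => ?_
      simp only [Finset.mem_sdiff, Set.mem_toFinset] at he
      simp only [Finset.mem_filter, Finset.mem_univ, true_and]
      exact ⟨he.2, mem_of_isEndpoint he.1 (hc e he.2)⟩
    have h3 := Finset.card_sdiff_add_card_inter (G.inner A) T.1.toFinset
    simp only [Finset.sdiff_empty]
    omega
  · rw [sum_chipDivisor]
    have h1 := T.card_add_one
    have h2 : (Finset.univ.filter fun e => e ∉ T.1 ∧ c e ∈ Finset.univ).card
        = Fintype.card E - T.1.toFinset.card := by
      rw [← Finset.card_compl]
      congr 1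
      ext e; simp
    have h3 := Finset.card_le_univ T.1.toFinset
    rw [h2, Finset.sdiff_empty, Finset.card_univ]
    omega

/-! ### Linear equivalence: uniqueness and existence in a class. -/

section Laplacian

variable [Fintype D]

open Classical in
theorem sum_mul_laplacian (f g : V → ℤ) :
    ∑ v, g v * G.laplacian f v = ∑ d, g (G.src d) * (f (G.src d) - f (G.tgt d)) := by
  simp only [laplacian, AddMonoidHom.coe_mk, ZeroHom.coe_mk, Finset.mul_sum, Finset.sum_filter]
  rw [Finset.sum_comm]
  refine Finset.sum_congr rfl fun d _ => ?_
  simp [eq_comm]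

/-- Summation by parts; the factor 2 appears because each edge carries two directed edges. -/
theorem sum_diff_mul_diff (f g : V → ℤ) :
    ∑ d, (f (G.src d) - f (G.tgt d)) * (g (G.src d) - g (G.tgt d)) =
      2 * ∑ v, g v * G.laplacian f v := by
  rw [sum_mul_laplacian, two_mul]
  nth_rewrite 2 [← sum_rev (G := G)]
  rw [← Finset.sum_add_distrib]
  refine Finset.sum_congr rfl fun d _ => ?_
  rw [G.src_rev, G.tgt_rev]
  ring

open Classical in
theorem sum_laplacian (f : V → ℤ) (A : Finset V) :
    ∑ v ∈ A, G.laplacian f v = ∑ d with G.src d ∈ A, (f (G.src d) - f (G.tgt d)) := by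
  have := sum_mul_laplacian (G := G) f fun v => if v ∈ A then 1 else 0
  simpa [Finset.sum_ite, Finset.filter_mem_eq_inter] using this

theorem sum_univ_laplacian (f : V → ℤ) : ∑ v, G.laplacian f v = 0 := by
  have h := sum_diff_mul_diff (G := G) f fun _ => 1
  simp at h
  exact h

open Classical in
/-- The number of edges leaving `A`. -/
noncomputable def cut (G : LooplessMultigraph V E D) (A : Finset V) : ℕ :=
  (Finset.univ.filter fun d => G.src d ∈ A ∧ G.tgt d ∉ A).card

open Classical in
theorem cut_eq (A : Finset V) :
    (Finset.univ.filter fun d => G.src d ∉ A ∧ G.tgt d ∈ A).card = G.cut A := by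
  rw [cut, Finset.card_filter, Finset.card_filter, ← sum_rev (G := G)]
  refine Finset.sum_congr rfl fun d _ => ?_
  rw [G.src_rev, G.tgt_rev]
  simp only [and_comm]

open Classical in
theorem card_src_mem (A : Finset V) :
    (Finset.univ.filter fun d => G.src d ∈ A).card = 2 * (G.inner A).card + G.cut A := by
  rw [← card_darts (G := G), cut,
    ← Finset.card_filter_add_card_filter_not (s := Finset.univ.filter fun d => G.src d ∈ A)
      fun d => G.tgt d ∈ A]
  simp only [Finset.filter_filter, edge_mem_inner]

open Classical in
theorem card_edge_eq (A : Finset V) :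
    (G.inner A).card + (G.inner Aᶜ).card + G.cut A = Fintype.card E := by
  have h1 := card_src_mem (G := G) A
  have h2 := card_src_mem (G := G) Aᶜ
  have h3 : G.cut Aᶜ = G.cut A := by
    rw [← cut_eq, cut]
    simp
  have h4 := Finset.card_filter_add_card_filter_not (s := (Finset.univ : Finset D))
    fun d => G.src d ∈ A
  have h5 := card_darts (G := G) Finset.univ
  simp only [Finset.mem_compl] at h2
  simp only [Finset.mem_univ, Finset.filter_true, Finset.card_univ] at h4 h5
  omega

/-- The lower bound for the complement of A, subtracted from the total degree. -/
theorem IsBreakMod.sum_le {F : V → ℤ} (hF : G.IsBreakMod ∅ ∅ F) (A : Finset V)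
    (hA : A ≠ Finset.univ) : ∑ v ∈ A, F v ≤ ((G.inner A).card : ℤ) - A.card + G.cut A := by
  classical
  have h1 := hF.le_sum Aᶜ (by rwa [Finset.nonempty_iff_ne_empty, Ne, Finset.compl_eq_empty_iff])
    (by intro d hd; simp at hd)
  have h2 := hF.sum_eq
  have h3 := card_edge_eq (G := G) A
  have h4 := Finset.sum_add_sum_compl A F
  have h5 := Finset.card_add_card_compl A
  simp only [Finset.sdiff_empty, Finset.card_univ] at h1 h2
  omega

/-- Maximum principle: on the set A where f is maximal, Δf has degree at least the size of the cut
of A. This exceeds by one the room between the lower bound for F(A) and the upper bound for F'(A),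
unless f is constant. -/
theorem eq_of_isBreakMod_of_cls_eq {F F' : V → ℤ} (hF : G.IsBreakMod ∅ ∅ F)
    (hF' : G.IsBreakMod ∅ ∅ F') (h : G.cls F = G.cls F') : F = F' := by
  classical
  rw [cls, cls, QuotientAddGroup.eq] at h
  obtain ⟨f, hf⟩ := h
  have hF'eq : F' = F + G.laplacian f := by rw [hf]; abel
  have := G.nonempty
  obtain ⟨m, hm⟩ := Finite.exists_max f
  set A := Finset.univ.filter fun v => f v = f m with hAdef
  by_cases hA : A = Finset.univ
  · have hconst : ∀ v, f v = f m := fun v => by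
      have : v ∈ A := hA ▸ Finset.mem_univ v
      simpa [hAdef] using this
    have : G.laplacian f = 0 := by
      ext v
      simp [laplacian, hconst]
    rw [hF'eq, this, add_zero]
  · exfalso
    have h1 := hF.le_sum A ⟨m, by simp [hAdef]⟩ (by intro d hd; simp at hd)
    have h2 := hF'.sum_le A hA
    have h3 : (G.cut A : ℤ) ≤ ∑ v ∈ A, G.laplacian f v := by
      rw [sum_laplacian, cut, Finset.card_filter, Finset.sum_filter]
      push_cast
      refine Finset.sum_le_sum fun d _ => ?_
      have hmt := hm (G.tgt d)
      by_cases hs : f (G.src d) = f m <;> by_cases ht : f (G.tgt d) = f m <;>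
        simp [hAdef, hs, ht]
      omega
    rw [hF'eq] at h2
    simp only [Pi.add_apply, Finset.sum_add_distrib] at h2
    simp only [Finset.sdiff_empty] at h1
    omega

/-- A divisor of degree zero is the boundary of a flow. -/
theorem exists_flow (h : V → ℤ) (h0 : ∑ v, h v = 0) :
    ∃ a : D → ℤ, ∀ f : V → ℤ, ∑ v, h v * f v = ∑ d, a d * (f (G.src d) - f (G.tgt d)) := by
  classical
  obtain ⟨r⟩ := G.nonempty
  have key : ∀ v, ∃ a : D → ℤ, ∀ f : V → ℤ,
      f v - f r = ∑ d, a d * (f (G.src d) - f (G.tgt d)) := by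
    intro v
    induction G.connected r v with
    | refl => exact ⟨0, by simp⟩
    | tail _ hd ih =>
      obtain ⟨d, rfl, rfl⟩ := hd
      obtain ⟨a, ha⟩ := ih
      refine ⟨a - Pi.single d 1, fun f => ?_⟩
      simp only [Pi.sub_apply, sub_mul, Finset.sum_sub_distrib (f := fun x => a x * _)]
      rw [← ha]
      simp only [Pi.single_apply, ite_mul, one_mul, zero_mul, Finset.sum_ite_eq',
        Finset.mem_univ, if_true, tgt]
      ring
  choose a ha using key
  refine ⟨fun d => ∑ v, h v * a v d, fun f => ?_⟩
  have : ∑ v, h v * f v = ∑ v, h v * (f v - f r) := by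
    simp only [mul_sub, Finset.sum_sub_distrib, ← Finset.sum_mul, h0]
    ring
  rw [this]
  simp only [ha, Finset.mul_sum, Finset.sum_mul]
  rw [Finset.sum_comm]
  simp only [mul_assoc]

open Classical in
theorem sum_indicator_diff_sq (A : Finset V) :
    ∑ d, (((if G.src d ∈ A then 1 else 0) - if G.tgt d ∈ A then 1 else 0) ^ 2 : ℤ) =
      2 * (G.cut A : ℤ) := by
  have h1 : (G.cut A : ℤ) = ∑ d, if G.src d ∈ A ∧ G.tgt d ∉ A then 1 else 0 := by
    rw [cut, Finset.card_filter]; push_cast; rfl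
  have h2 : (G.cut A : ℤ) = ∑ d, if G.src d ∉ A ∧ G.tgt d ∈ A then 1 else 0 := by
    rw [← cut_eq, Finset.card_filter]; push_cast; rfl
  rw [two_mul]
  nth_rewrite 1 [h1]
  rw [h2, ← Finset.sum_add_distrib]
  refine Finset.sum_congr rfl fun d _ => ?_
  by_cases hs : G.src d ∈ A <;> by_cases ht : G.tgt d ∈ A <;> simp [hs, ht]

/-- Every divisor of degree `g` is linearly equivalent to one satisfying the inequalities of a
break divisor, namely to one minimizing a suitable energy. -/
theorem exists_isBreakMod_add_laplacian (F : V → ℤ) (hF : degree F = G.genus) :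
    ∃ f : V → ℤ, G.IsBreakMod ∅ ∅ (F + G.laplacian f) := by
  classical
  have hdeg : ∑ v, F v = G.genus := hF
  set n : ℤ := ((Fintype.card V : ℕ) : ℤ) with hn
  have hnpos : 0 < n := by
    have := G.nonempty
    rw [hn]; exact_mod_cast Fintype.card_pos
  set val : V → ℤ := fun v => ((Finset.univ.filter fun d => G.src d = v).card : ℤ) with hval
  have hvalA : ∀ A : Finset V, ∑ v ∈ A, val v = 2 * (G.inner A).card + G.cut A := by
    intro A
    have h1 := card_src_mem (G := G) A
    rw [Finset.card_eq_sum_card_fiberwise (f := G.src) (t := A) (by intro d; simp)] at h1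
    have h2 : ∑ v ∈ A, val v = ((∑ b ∈ A, ((Finset.univ.filter fun d => G.src d ∈ A).filter
        fun d => G.src d = b).card : ℕ) : ℤ) := by
      push_cast
      refine Finset.sum_congr rfl fun v hv => ?_
      rw [hval, Finset.filter_filter]
      simp only
      congr 2
      ext d
      simp only [Finset.mem_filter, Finset.mem_univ, true_and]
      exact ⟨fun h => ⟨h ▸ hv, h⟩, fun h => h.2⟩
    rw [h2, h1]; push_cast; ring
  -- The linear coefficient is chosen so that comparing a minimizer f with f + 1_A yields the
  -- inequality for A. The constant -2 makes the total vanish in degree g and leaves a surplus #A/n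
  -- > 0 in that inequality, which integrality rounds up to the required +1.
  set h : V → ℤ := fun v => 2 * n * F v - n * val v + 2 * n - 2 with hh
  have hhA : ∀ A : Finset V, ∑ v ∈ A, h v = 2 * n * ∑ v ∈ A, F v
      - n * (2 * (G.inner A).card + G.cut A) + (2 * n - 2) * A.card := by
    intro A
    rw [← hvalA A]
    simp only [hh, Finset.sum_add_distrib, Finset.sum_sub_distrib, Finset.mul_sum,
      Finset.sum_const, nsmul_eq_mul]
    ring
  have hh0 : ∑ v, h v = 0 := by
    have hcut : G.cut Finset.univ = 0 := by simp [cut]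
    rw [hhA, hdeg, inner_univ, hcut, Finset.card_univ, Finset.card_univ, genus, ← hn]
    push_cast; ring
  obtain ⟨a, ha⟩ := exists_flow (G := G) h hh0
  set Φ : (V → ℤ) → ℤ := fun f =>
    2 * ∑ v, h v * f v + n * ∑ d, (f (G.src d) - f (G.tgt d)) ^ 2 with hΦ
  have hbdd : ∀ f, -∑ d, a d ^ 2 ≤ Φ f := by
    intro f
    -- With h written as the flow a, the energy is a sum over directed edges of 2ax + nx², and each
    -- term is at least -a² since n ≥ 1.
    simp only [hΦ, ha, Finset.mul_sum, ← Finset.sum_add_distrib, ← Finset.sum_neg_distrib]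
    refine Finset.sum_le_sum fun d _ => ?_
    nlinarith [sq_nonneg (a d + (f (G.src d) - f (G.tgt d))),
      mul_nonneg (show 0 ≤ n - 1 by omega) (sq_nonneg (f (G.src d) - f (G.tgt d)))]
  obtain ⟨m, ⟨f, rfl⟩, hmin⟩ := Int.exists_least_of_bdd (P := fun z => ∃ f, Φ f = z)
    ⟨-∑ d, a d ^ 2, by rintro _ ⟨f, rfl⟩; exact hbdd f⟩ ⟨_, 0, rfl⟩
  refine ⟨f, ?_, ?_⟩
  · intro A hA _
    set χ : V → ℤ := fun v => if v ∈ A then 1 else 0 with hχ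
    have h1 := hmin (Φ (f + χ)) ⟨_, rfl⟩
    have h2 : Φ (f + χ) = Φ f + 2 * ∑ v ∈ A, h v +
        n * (4 * ∑ v ∈ A, G.laplacian f v + 2 * G.cut A) := by
      have e1 : ∑ v ∈ A, h v = ∑ v, h v * χ v := by simp [hχ]
      have e2 : ∑ v ∈ A, G.laplacian f v = ∑ v, χ v * G.laplacian f v := by simp [hχ]
      rw [e1, e2, ← sum_indicator_diff_sq,
        show 4 * ∑ v, χ v * G.laplacian f v = 2 * (2 * ∑ v, χ v * G.laplacian f v) by ring,
        ← sum_diff_mul_diff]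
      simp only [hΦ, Finset.mul_sum, Pi.add_apply, mul_add, Finset.sum_add_distrib]
      simp only [add_assoc]
      congr 1
      rw [add_left_comm]
      congr 1
      rw [← Finset.sum_add_distrib, ← Finset.sum_add_distrib]
      refine Finset.sum_congr rfl fun d _ => ?_
      ring
    rw [h2, hhA] at h1
    have hApos : 0 < A.card := hA.card_pos
    simp only [Pi.add_apply, Finset.sum_add_distrib, Finset.sdiff_empty]
    have h3 : 0 < n * (∑ v ∈ A, F v + ∑ v ∈ A, G.laplacian f v - (G.inner A).card + A.card) := by
      have : (0 : ℤ) < A.card := by exact_mod_cast hApos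
      nlinarith
    have h4 := (mul_pos_iff_of_pos_left hnpos).1 h3
    omega
  · simp only [Pi.add_apply, Finset.sum_add_distrib, sum_univ_laplacian, hdeg, genus,
      Finset.sdiff_empty, Finset.card_univ, add_zero]

end Laplacian

end

end LooplessMultigraph

/-! ### Counting by deletion and contraction. -/

namespace LooplessMultigraph

variable {V E D : Type*} {G : LooplessMultigraph V E D} [Fintype V] [Fintype E]

open Classical in
theorem Saturated.compl {K : Set E} {A : Finset V} (h : G.Saturated K A) :
    G.Saturated K Aᶜ := by
  intro d hd hs
  rw [Finset.mem_compl] at hs ⊢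
  exact fun ht => hs ((h.mem_iff hd).2 ht)

open Classical in
theorem Saturated.union {K : Set E} {A B : Finset V} (h : G.Saturated K A)
    (h' : G.Saturated K B) : G.Saturated K (A ∪ B) := by
  intro d hd hs
  rw [Finset.mem_union] at hs ⊢
  exact hs.imp (h d hd) (h' d hd)

open Classical in
theorem Saturated.inter {K : Set E} {A B : Finset V} (h : G.Saturated K A)
    (h' : G.Saturated K B) : G.Saturated K (A ∩ B) := by
  intro d hd hs
  rw [Finset.mem_inter] at hs ⊢
  exact hs.imp (h d hd) (h' d hd)

open Classical in
theorem Saturated.insert {K : Finset E} {A : Finset V} (h : G.Saturated K A) {d : D}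
    (hd : G.src d ∈ A ↔ G.tgt d ∈ A) :
    G.Saturated (insert (G.edge d) K : Finset E) A := by
  intro y hy hs
  rw [Finset.coe_insert] at hy
  rcases hy with hy | hy
  · rcases (G.edge_eq_iff _ _).1 hy with h' | h'
    · rw [h'] at hd; exact hd.1 hs
    · rw [h', G.src_rev, G.tgt_rev] at hd; exact hd.2 hs
  · exact h y hy hs

open Classical in
theorem card_sdiff_insert_add_one {S C : Finset E} {e : E} (he : e ∈ S) (heC : e ∉ C) :
    (S \ insert e C).card + 1 = (S \ C).card := by
  rw [Finset.sdiff_insert, Finset.card_erase_add_one (by simp [he, heC])]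

open Classical in
theorem card_sdiff_insert_of_notMem {S C : Finset E} {e : E} (he : e ∉ S) :
    (S \ insert e C).card = (S \ C).card := by
  congr 1
  ext x
  simp only [Finset.mem_sdiff, Finset.mem_insert, not_or]
  exact ⟨fun h => ⟨h.1, h.2.2⟩, fun h => ⟨h.1, fun hx => he (hx ▸ h.1), h.2⟩⟩

open Classical in
/-- If a chip on the edge of `d` cannot be removed at the source of `d`, then there is a tight set
of vertices which separates this source from the target. -/
theorem IsBreakMod.exists_tight {K C : Finset E} {F : V → ℤ} (hF : G.IsBreakMod K C F) {d : D}
    (hC : G.edge d ∉ C)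
    (h : ¬ G.IsBreakMod K (insert (G.edge d) C) (F - Pi.single (G.src d) 1)) :
    ∃ A : Finset V, G.Saturated K A ∧ A.Nonempty ∧ G.src d ∈ A ∧ G.tgt d ∉ A ∧
      ∑ v ∈ A, F v = ((G.inner A \ C).card : ℤ) - A.card + 1 := by
  have hsum : ∀ A : Finset V, ∑ v ∈ A, (F - Pi.single (G.src d) 1 : V → ℤ) v =
      ∑ v ∈ A, F v - if G.src d ∈ A then 1 else 0 := by
    intro A
    simp [Finset.sum_sub_distrib, Pi.single_apply]
  by_contra hno
  push Not at hno
  -- Deleting the edge lowers the bound by one for sets containing both endpoints, so only a set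
  -- containing the source but not the target can fail, and only if it was tight.
  refine h ⟨fun A hA hK => ?_, ?_⟩
  · rw [hsum]
    have h1 := hF.le_sum A hA hK
    by_cases hs : G.src d ∈ A
    · by_cases ht : G.tgt d ∈ A
      · have := card_sdiff_insert_add_one (edge_mem_inner.2 ⟨hs, ht⟩) hC
        rw [if_pos hs]
        omega
      · have h2 := hno A hK hA hs ht
        rw [if_pos hs, card_sdiff_insert_of_notMem (fun h => ht (edge_mem_inner.1 h).2)]
        omega
    · rw [if_neg hs, card_sdiff_insert_of_notMem (fun h => hs (edge_mem_inner.1 h).1)]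
      omega
  · rw [hsum, if_pos (Finset.mem_univ _)]
    have := hF.sum_eq
    have := card_sdiff_insert_add_one (Finset.mem_univ (G.edge d)) hC
    omega

-- Injectivity of the contraction step: divisors from which no chip can be removed at the source of
-- d are determined by their degrees on sets that do not separate the endpoints of d.
open Classical in
theorem IsBreakMod.sum_eq_of_tight {K C : Finset E} {F F' : V → ℤ} (hF : G.IsBreakMod K C F)
    (hF' : G.IsBreakMod K C F') {d : D} (hC : G.edge d ∉ C)
    (h : ¬ G.IsBreakMod K (insert (G.edge d) C) (F - Pi.single (G.src d) 1))
    (h' : ¬ G.IsBreakMod K (insert (G.edge d) C) (F' - Pi.single (G.src d) 1))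
    (heq : ∀ A, G.Saturated (insert (G.edge d) K : Finset E) A → ∑ v ∈ A, F v = ∑ v ∈ A, F' v)
    (X : Finset V) (hX : G.Saturated K X) : ∑ v ∈ X, F v = ∑ v ∈ X, F' v := by
  obtain ⟨A, hAK, hA, hAs, hAt, hAF⟩ := hF.exists_tight hC h
  obtain ⟨A', hAK', hA', hAs', hAt', hAF'⟩ := hF'.exists_tight hC h'
  -- The union of X with the complement of A contains both endpoints, and their intersection
  -- contains neither. Hence F - F' has the same degree on X as on A.
  have hdiff : ∀ X, G.Saturated K X → G.src d ∈ X → G.tgt d ∉ X →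
      ∑ v ∈ X, F v - ∑ v ∈ X, F' v = ∑ v ∈ A, F v - ∑ v ∈ A, F' v := by
    intro X hX hs ht
    have h1 := heq (X ∪ Aᶜ) ((hX.union hAK.compl).insert (by simp [hs, hAt]))
    have h2 := heq (X ∩ Aᶜ) ((hX.inter hAK.compl).insert (by simp [ht, hAs]))
    have h3 := Finset.sum_union_inter (s₁ := X) (s₂ := Aᶜ) (f := F)
    have h4 := Finset.sum_union_inter (s₁ := X) (s₂ := Aᶜ) (f := F')
    have h5 := Finset.sum_add_sum_compl A F
    have h6 := Finset.sum_add_sum_compl A F'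
    have h7 := hF.sum_eq
    have h8 := hF'.sum_eq
    omega
  -- Tightness of F on A and of F' on A' bounds this common difference from both sides.
  have hzero : ∑ v ∈ A, F v = ∑ v ∈ A, F' v := by
    have h1 := hF'.le_sum A hA hAK
    have h2 := hF.le_sum A' hA' hAK'
    have h3 := hdiff A' hAK' hAs' hAt'
    omega
  by_cases hs : G.src d ∈ X <;> by_cases ht : G.tgt d ∈ X
  · exact heq X (hX.insert (by simp [hs, ht]))
  · have := hdiff X hX hs ht
    omega
  · have h1 := hdiff Xᶜ hX.compl (by simpa using hs) (by simpa using ht)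
    have h5 := Finset.sum_add_sum_compl X F
    have h6 := Finset.sum_add_sum_compl X F'
    have h7 := hF.sum_eq
    have h8 := hF'.sum_eq
    omega
  · exact heq X (hX.insert (by simp [hs, ht]))

/-- The spanning trees which contain `K` and avoid `C`. -/
def treesBetween (G : LooplessMultigraph V E D) (K C : Finset E) : Set G.SpanningTree :=
  {T | (∀ e ∈ K, e ∈ T.1) ∧ ∀ e ∈ C, e ∉ T.1}

open Classical in
theorem ncard_treesBetween_insert (K C : Finset E) (e : E) :
    (G.treesBetween K (insert e C)).ncard + (G.treesBetween (insert e K) C).ncard ≤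
      (G.treesBetween K C).ncard := by
  rw [← Set.ncard_union_eq]
  · refine Set.ncard_le_ncard ?_
    rintro T (h | h)
    · exact ⟨h.1, fun x hx => h.2 x (Finset.mem_insert_of_mem hx)⟩
    · exact ⟨fun x hx => h.1 x (Finset.mem_insert_of_mem hx), h.2⟩
  · rw [Set.disjoint_left]
    intro T h h'
    exact h.2 e (Finset.mem_insert_self _ _) (h'.1 e (Finset.mem_insert_self _ _))

-- If K were disconnected, the bounds for a component and for its complement would add up to one
-- more than the degree.
open Classical in
theorem IsBreakMod.connectedBy {K C : Finset E} (hU : Finset.univ \ (K ∪ C) = ∅) {F : V → ℤ} (hF : G.IsBreakMod K C F) :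
    G.ConnectedBy (K : Set E) := by
  by_contra hK
  simp only [ConnectedBy, not_forall] at hK
  obtain ⟨u, w, huw⟩ := hK
  set A := Finset.univ.filter fun x => G.Conn (K : Set E) u x with hA
  have hAK : G.Saturated K A := by
    intro d hd hs
    simp only [hA, Finset.mem_filter, Finset.mem_univ, true_and] at hs ⊢
    exact hs.trans (Conn.dart hd)
  have h1 := hF.le_sum A ⟨u, by simp [hA, Conn.refl]⟩ hAK
  have h2 := hF.le_sum Aᶜ ⟨w, by simpa [hA] using (show ¬ G.Conn (K : Set E) u w from huw)⟩ hAK.compl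
  have h3 := Finset.sum_add_sum_compl A F
  have h4 := hF.sum_eq
  have h5 := Finset.card_add_card_compl A
  have h6 : (Finset.univ \ C).card ≤ (G.inner A \ C).card + (G.inner Aᶜ \ C).card := by
    refine le_trans (Finset.card_le_card fun e he => ?_) (Finset.card_union_le _ _)
    have heC : e ∉ C := by simpa using he
    have heK : e ∈ K := by
      by_contra h
      have : e ∈ Finset.univ \ (K ∪ C) := by simp [h, heC]
      simp [hU] at this
    obtain ⟨d, rfl⟩ := G.edge_surjective e
    have := hAK.mem_iff (d := d) heK
    simp only [Finset.mem_union, Finset.mem_sdiff, edge_mem_inner, heC, not_false_eq_true,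
      and_true, Finset.mem_compl]
    tauto
  omega

open Classical in
/-- There are at most as many break divisors as spanning trees. This is proved for all the graphs
obtained by deleting `C` and contracting `K`. -/
theorem card_le_ncard_treesBetween (K C : Finset E) (hKC : Disjoint K C)
    (hK : ¬ G.HasCycle (K : Set E)) (𝓕 : Finset (V → ℤ)) (hF : ∀ F ∈ 𝓕, G.IsBreakMod K C F)
    (hinj : ∀ F ∈ 𝓕, ∀ F' ∈ 𝓕,
      (∀ A, G.Saturated K A → ∑ v ∈ A, F v = ∑ v ∈ A, F' v) → F = F') :
    𝓕.card ≤ (G.treesBetween K C).ncard := by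
  induction hm : (Finset.univ \ (K ∪ C)).card generalizing K C 𝓕 with
  | zero =>
    rw [Finset.card_eq_zero] at hm
    rcases 𝓕.eq_empty_or_nonempty with rfl | ⟨F₀, hF₀⟩
    · simp
    have hconn := (hF F₀ hF₀).connectedBy hm
    have h1 : 𝓕.card ≤ 1 := by
      rw [Finset.card_le_one]
      intro F hF1 F' hF2
      refine hinj F hF1 F' hF2 fun A hA => ?_
      rcases A.eq_empty_or_nonempty with rfl | ⟨a, ha⟩
      · simp
      · have : A = Finset.univ := by
          ext x
          simp only [Finset.mem_univ, iff_true]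
          exact (hA.mem_iff_of_conn (hconn a x)).1 ha
        rw [this, (hF F hF1).sum_eq, (hF F' hF2).sum_eq]
    refine h1.trans ?_
    rw [Nat.one_le_iff_ne_zero, ← Nat.pos_iff_ne_zero, Set.ncard_pos]
    exact ⟨⟨(K : Set E), hconn, hK⟩, fun e he => he, fun e he heK =>
      Finset.disjoint_left.1 hKC heK he⟩
  | succ m ih =>
    obtain ⟨e, he⟩ : (Finset.univ \ (K ∪ C)).Nonempty := by
      rw [← Finset.card_pos]; omega
    have hmem := he
    simp only [Finset.mem_sdiff, Finset.mem_univ, true_and, Finset.mem_union, not_or] at he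
    obtain ⟨heK, heC⟩ := he
    obtain ⟨d, rfl⟩ := G.edge_surjective e
    -- Divisors from which a chip can be removed at the source of d are counted by trees avoiding
    -- the edge, the others by trees containing it.
    set p : (V → ℤ) → Prop := fun F =>
      G.IsBreakMod K (insert (G.edge d) C) (F - Pi.single (G.src d) 1) with hp
    have hcardm : (Finset.univ \ insert (G.edge d) (K ∪ C)).card = m := by
      have := card_sdiff_insert_add_one (Finset.mem_univ (G.edge d))
        (show G.edge d ∉ K ∪ C by simp [heK, heC])
      omega
    have h1 : (𝓕.filter p).card ≤ (G.treesBetween K (insert (G.edge d) C)).ncard := by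
      rw [← Finset.card_image_of_injective (f := fun F => F - Pi.single (G.src d) 1) _
        (sub_left_injective)]
      refine ih K (insert (G.edge d) C) ?_ hK _ ?_ ?_ ?_
      · rw [Finset.disjoint_insert_right]; exact ⟨heK, hKC⟩
      · intro F hF'
        obtain ⟨F₁, hF₁, rfl⟩ := Finset.mem_image.1 hF'
        exact (Finset.mem_filter.1 hF₁).2
      · intro F hF1 F' hF2 h
        obtain ⟨F₁, hF₁, rfl⟩ := Finset.mem_image.1 hF1
        obtain ⟨F₂, hF₂, rfl⟩ := Finset.mem_image.1 hF2
        rw [hinj F₁ (Finset.mem_filter.1 hF₁).1 F₂ (Finset.mem_filter.1 hF₂).1 fun A hA => ?_]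
        simpa [Finset.sum_sub_distrib] using h A hA
      · rw [Finset.union_insert, hcardm]
    have h2 : (𝓕.filter fun F => ¬ p F).card ≤
        (G.treesBetween (insert (G.edge d) K) C).ncard := by
      rcases (𝓕.filter fun F => ¬ p F).eq_empty_or_nonempty with h | ⟨F₀, hF₀⟩
      · rw [h]; simp
      obtain ⟨hF₀, hpF₀⟩ := Finset.mem_filter.1 hF₀
      obtain ⟨A, hAK, -, hAs, hAt, -⟩ := (hF F₀ hF₀).exists_tight heC hpF₀
      -- The tight set is saturated and separates the endpoints, so contracting the edge keeps K
      -- acyclic.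
      have hnc : ¬ G.Conn (K : Set E) (G.src d) (G.tgt d) := fun h =>
        hAt ((hAK.mem_iff_of_conn h).1 hAs)
      refine ih (insert (G.edge d) K) C ?_ ?_ _ ?_ ?_ ?_
      · rw [Finset.disjoint_insert_left]; exact ⟨heC, hKC⟩
      · rw [Finset.coe_insert]; exact not_hasCycle_insert hK hnc
      · intro F hF'
        have hF'' := hF F (Finset.mem_filter.1 hF').1
        exact ⟨fun A hA hs => hF''.le_sum A hA fun y hy =>
          hs y (by rw [Finset.coe_insert]; exact Or.inr hy), hF''.sum_eq⟩
      · intro F hF1 F' hF2 h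
        obtain ⟨hF1, hp1⟩ := Finset.mem_filter.1 hF1
        obtain ⟨hF2, hp2⟩ := Finset.mem_filter.1 hF2
        exact hinj F hF1 F' hF2 ((hF F hF1).sum_eq_of_tight (hF F' hF2) heC hp1 hp2 h)
      · rw [Finset.insert_union, hcardm]
    have h3 := Finset.card_filter_add_card_filter_not (s := 𝓕) p
    have h4 := ncard_treesBetween_insert (G := G) K C (G.edge d)
    omega

theorem not_hasCycle_empty : ¬ G.HasCycle (∅ : Set E) := by
  rintro ⟨n, c, h, -⟩
  exact h 0

theorem card_le_card_spanningTree (𝓕 : Finset (V → ℤ)) (hF : ∀ F ∈ 𝓕, G.IsBreakMod ∅ ∅ F) :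
    𝓕.card ≤ Nat.card G.SpanningTree := by
  classical
  have h := card_le_ncard_treesBetween (G := G) ∅ ∅ (by simp)
    (by simpa using not_hasCycle_empty) 𝓕 hF fun F _ F' _ h => by
      ext v
      simpa using h {v} (by intro d hd; simp at hd)
  refine h.trans ?_
  rw [← Set.ncard_univ]
  exact Set.ncard_le_ncard (Set.subset_univ _)

end LooplessMultigraph

/-! ### Cycles of a permutation multiplied by a transposition. -/

namespace Equiv.Perm

variable {α : Type*} [Finite α]

theorem SameCycle.of_forall_rel {π : Perm α} {r : α → α → Prop} (hr : Equivalence r)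
    (h : ∀ z, r z (π z)) {a b : α} (hab : π.SameCycle a b) : r a b := by
  obtain ⟨n, -, rfl⟩ := hab.exists_pow_eq'
  clear hab
  induction n with
  | zero => exact hr.refl _
  | succ n ih => rw [pow_succ', mul_apply]; exact hr.trans ih (h _)

theorem sameCycle_equivalence (π : Perm α) : Equivalence π.SameCycle :=
  ⟨SameCycle.refl π, SameCycle.symm, SameCycle.trans⟩

theorem sameCycle_self_apply (π : Perm α) (z : α) : π.SameCycle z (π z) :=
  (sameCycle_apply_right).2 (SameCycle.refl π z)

variable [DecidableEq α]

/-- Multiplying by a transposition of elements of different cycles merges these cycles. -/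
theorem sameCycle_mul_swap {π : Perm α} {x y : α} (h : ¬ π.SameCycle x y) :
    (π * swap x y).SameCycle x y := by
  by_contra hno
  -- The new permutation sends x to π y and then follows the old cycle of y, which never meets x,
  -- until it returns to y.
  have key : ∀ n : ℕ, (π * swap x y).SameCycle x ((π ^ (n + 1)) y) := by
    intro n
    induction n with
    | zero =>
      have := sameCycle_self_apply (π * swap x y) x
      simpa using this
    | succ n ih =>
      have hx : (π ^ (n + 1)) y ≠ x := fun hx => h (SameCycle.symm ⟨(n + 1 : ℕ), by
        rw [zpow_natCast]; exact hx⟩)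
      have hy : (π ^ (n + 1)) y ≠ y := fun hy => hno (by rwa [hy] at ih)
      have := ih.trans (sameCycle_self_apply (π * swap x y) _)
      rwa [mul_apply, swap_apply_of_ne_of_ne hx hy, ← mul_apply, ← pow_succ'] at this
  have h2 := key (orderOf π - 1)
  rw [Nat.sub_add_cancel (orderOf_pos π), pow_orderOf_eq_one, one_apply] at h2
  exact hno h2

theorem SameCycle.mul_swap {π : Perm α} {x y : α} (h : ¬ π.SameCycle x y) {a b : α}
    (hab : π.SameCycle a b) : (π * swap x y).SameCycle a b := by
  have hxy := sameCycle_mul_swap h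
  refine hab.of_forall_rel (sameCycle_equivalence _) fun z => ?_
  have hz := sameCycle_self_apply (π * swap x y)
  by_cases h1 : z = x
  · have := hz y
    rw [mul_apply, swap_apply_right] at this
    exact h1 ▸ hxy.trans this
  by_cases h2 : z = y
  · have := hz x
    rw [mul_apply, swap_apply_left] at this
    exact h2 ▸ hxy.symm.trans this
  have := hz z
  rwa [mul_apply, swap_apply_of_ne_of_ne h1 h2] at this

/-- The number of cycles of a permutation, fixed points included. -/
noncomputable def numCycles (π : Perm α) : ℕ := Nat.card (Quotient (SameCycle.setoid π))

theorem numCycles_mul_swap_le_of_not_sameCycle {π : Perm α} {x y : α} (h : ¬ π.SameCycle x y) :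
    (π * swap x y).numCycles ≤ π.numCycles := by
  refine Nat.card_le_card_of_surjective
    (Quotient.map (sa := SameCycle.setoid π) (sb := SameCycle.setoid (π * swap x y)) id
      fun a b hab => SameCycle.mul_swap h hab) ?_
  rintro ⟨a⟩
  exact ⟨Quotient.mk _ a, rfl⟩

-- Within one cycle, the product can only split it into the cycles of x and of y. Discarding the
-- cycle of y, sent to `none`, the remaining new cycles inject into the old ones.
open Classical in
theorem numCycles_mul_swap_le (π : Perm α) (x y : α) :
    (π * swap x y).numCycles ≤ π.numCycles + 1 := by
  by_cases h : π.SameCycle x y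
  swap
  · exact (numCycles_mul_swap_le_of_not_sameCycle h).trans (Nat.le_succ _)
  set π' := π * swap x y with hπ'
  have hx : π' x = π y := by simp [hπ']
  have hy : π' y = π x := by simp [hπ']
  have ho : ∀ z, z ≠ x → z ≠ y → π' z = π z := fun z h1 h2 => by
    rw [hπ', mul_apply, swap_apply_of_ne_of_ne h1 h2]
  have hsub : ∀ a b, π'.SameCycle a b → π.SameCycle a b := fun a b hab => by
    refine hab.of_forall_rel (sameCycle_equivalence _) fun z => ?_
    by_cases h1 : z = x
    · rw [h1, hx]; exact h.trans (sameCycle_self_apply π y)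
    by_cases h2 : z = y
    · rw [h2, hy]; exact h.symm.trans (sameCycle_self_apply π x)
    rw [ho z h1 h2]; exact sameCycle_self_apply π z
  let P : α → Prop := fun a => π'.SameCycle x a ∨ π'.SameCycle y a
  have hP : ∀ a b, π'.SameCycle a b → P a → P b := fun a b hab =>
    Or.imp (fun h => h.trans hab) (fun h => h.trans hab)
  have hequiv : Equivalence fun a b => π'.SameCycle a b ∨ (P a ∧ P b) := by
    refine ⟨fun a => Or.inl (SameCycle.refl _ _), ?_, ?_⟩
    · rintro a b (h | ⟨h1, h2⟩)
      · exact Or.inl h.symm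
      · exact Or.inr ⟨h2, h1⟩
    · rintro a b c (h | ⟨h1, h2⟩) (h' | ⟨h3, h4⟩)
      · exact Or.inl (h.trans h')
      · exact Or.inr ⟨hP _ _ h.symm h3, h4⟩
      · exact Or.inr ⟨h1, hP _ _ h' h2⟩
      · exact Or.inr ⟨h1, h4⟩
  have hsup : ∀ a b, π.SameCycle a b → π'.SameCycle a b ∨ (P a ∧ P b) := fun a b hab => by
    refine hab.of_forall_rel hequiv fun z => ?_
    by_cases h1 : z = x
    · right
      rw [h1, ← hy]
      exact ⟨Or.inl (SameCycle.refl _ _), Or.inr (sameCycle_self_apply π' y)⟩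
    by_cases h2 : z = y
    · right
      rw [h2, ← hx]
      exact ⟨Or.inr (SameCycle.refl _ _), Or.inl (sameCycle_self_apply π' x)⟩
    left
    rw [← ho z h1 h2]
    exact sameCycle_self_apply π' z
  let g : Quotient (SameCycle.setoid π') → Option (Quotient (SameCycle.setoid π)) := fun q =>
    if q = Quotient.mk (SameCycle.setoid π') y then none else
      some (Quotient.map (sa := SameCycle.setoid π') (sb := SameCycle.setoid π) id hsub q)
  have hg : Function.Injective g := by
    rintro ⟨a⟩ ⟨b⟩ hab
    change g (Quotient.mk _ a) = g (Quotient.mk _ b) at hab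
    change Quotient.mk (SameCycle.setoid π') a = Quotient.mk (SameCycle.setoid π') b
    simp only [g] at hab
    split_ifs at hab with h1 h2 h2
    · rw [h1, h2]
    · have hab' := Quotient.exact (Option.some_injective _ hab)
      have h1' : ¬ π'.SameCycle a y := fun h => h1 (Quotient.sound h)
      have h2' : ¬ π'.SameCycle b y := fun h => h2 (Quotient.sound h)
      apply Quotient.sound
      rcases hsup a b hab' with h | ⟨h3, h4⟩
      · exact h
      · exact ((h3.resolve_right fun h => h1' h.symm).symm).trans
          (h4.resolve_right fun h => h2' h.symm)
  have := Nat.card_le_card_of_injective g hg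
  rwa [Finite.card_option] at this

end Equiv.Perm

open LooplessMultigraph

/-! ### The tour as a permutation of the directed edges. -/

namespace RibbonGraph

variable {V E D : Type*} {G : RibbonGraph V E D}

open Classical in
/-- The involution reversing the directed edges with underlying edge in `T`. -/
noncomputable def revOn (G : RibbonGraph V E D) (T : Set E) : Equiv.Perm D :=
  Function.Involutive.toPerm (fun d => if G.edge d ∈ T then G.rev d else d) fun d => by
    by_cases h : G.edge d ∈ T <;> simp [h, G.edge_rev, G.rev_rev]

open Classical in
theorem revOn_apply (T : Set E) (d : D) :
    G.revOn T d = if G.edge d ∈ T then G.rev d else d := rfl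

/-- A step of the tour around `T`, as a permutation of the directed edges. -/
noncomputable def tourPerm (G : RibbonGraph V E D) (T : Set E) : Equiv.Perm D :=
  G.next * G.revOn T

theorem tourPerm_apply (T : Set E) (d : D) : G.tourPerm T d = G.tourStep T d := by
  rw [tourPerm, Equiv.Perm.mul_apply, revOn_apply, tourStep]
  split_ifs <;> rfl

theorem tourStep_of_mem {T : Set E} {d : D} (h : G.edge d ∈ T) :
    G.tourStep T d = G.next (G.rev d) := by rw [tourStep, if_pos h]

theorem tourStep_of_notMem {T : Set E} {d : D} (h : G.edge d ∉ T) :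
    G.tourStep T d = G.next d := by rw [tourStep, if_neg h]

theorem src_tourStep_of_mem {T : Set E} {d : D} (h : G.edge d ∈ T) :
    G.src (G.tourStep T d) = G.tgt d := by rw [tourStep_of_mem h, G.src_next, G.src_rev]

theorem src_tourStep_of_notMem {T : Set E} {d : D} (h : G.edge d ∉ T) :
    G.src (G.tourStep T d) = G.src d := by rw [tourStep_of_notMem h, G.src_next]

theorem tourPerm_empty : G.tourPerm ∅ = G.next := by
  ext d
  rw [tourPerm_apply, tourStep_of_notMem (Set.notMem_empty _)]

theorem tourPerm_univ_apply (d : D) : G.tourPerm Set.univ d = G.next (G.rev d) := by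
  rw [tourPerm_apply, tourStep_of_mem (Set.mem_univ _)]

-- Adding an edge multiplies the tour by a transposition, so the cycle counts for permutations
-- govern how tours merge and split.
open Classical in
theorem tourPerm_insert {T : Set E} {d : D} (h : G.edge d ∉ T) :
    G.tourPerm (insert (G.edge d) T) = G.tourPerm T * Equiv.swap d (G.rev d) := by
  rw [tourPerm, tourPerm, mul_assoc]
  congr 1
  ext y
  rw [Equiv.Perm.mul_apply, revOn_apply, revOn_apply]
  by_cases hy : y = d
  · subst hy
    simp [G.edge_rev, h]
  by_cases hy' : y = G.rev d
  · subst hy'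
    simp [G.edge_rev, h, G.rev_rev]
  have : G.edge y ≠ G.edge d := fun he => by
    rcases (G.edge_eq_iff _ _).1 he.symm with h | h
    · exact hy h
    · exact hy' h
  rw [Equiv.swap_apply_of_ne_of_ne hy hy', Set.mem_insert_iff]
  simp [this]

theorem conn_src_of_sameCycle [Finite D] {T : Set E} {a b : D}
    (h : (G.tourPerm T).SameCycle a b) : G.Conn T (G.src a) (G.src b) := by
  refine h.of_forall_rel (r := fun a b => G.Conn T (G.src a) (G.src b))
    ⟨fun _ => Conn.refl _ _, fun h => h.symm, fun h h' => h.trans h'⟩ fun z => ?_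
  rw [tourPerm_apply]
  by_cases hz : G.edge z ∈ T
  · rw [src_tourStep_of_mem hz]; exact Conn.dart hz
  · rw [src_tourStep_of_notMem hz]; exact Conn.refl _ _

theorem hasCycle_mono {T T' : Set E} (h : T ⊆ T') (hT : G.HasCycle T) : G.HasCycle T' := by
  obtain ⟨n, c, hc, h'⟩ := hT
  exact ⟨n, c, fun i => h (hc i), h'⟩

/-- A tour stays in one component of T. An edge joining two components therefore joins two different
cycles, which merge, while relations already obtained persist. -/
theorem sameCycle_tourPerm_of_not_hasCycle [Finite D] {T : Set E} (hfin : T.Finite)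
    (hT : ¬ G.HasCycle T) :
    (∀ z, (G.tourPerm T).SameCycle z (G.next z)) ∧
      ∀ z, G.edge z ∈ T → (G.tourPerm T).SameCycle z (G.rev z) := by
  classical
  induction T, hfin using Set.Finite.induction_on with
  | empty =>
    refine ⟨fun z => ?_, fun z hz => absurd hz (Set.notMem_empty _)⟩
    rw [tourPerm_empty]
    exact Equiv.Perm.sameCycle_self_apply _ _
  | @insert e T he _ ih =>
    obtain ⟨ih1, ih2⟩ := ih fun h => hT (hasCycle_mono (Set.subset_insert _ _) h)
    obtain ⟨d, rfl⟩ := G.edge_surjective e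
    have hd : ¬ (G.tourPerm T).SameCycle d (G.rev d) := fun h => by
      have h1 := not_conn_diff_of_not_hasCycle hT (Set.mem_insert _ _)
      rw [Set.insert_sdiff_of_mem _ (Set.mem_singleton _), Set.sdiff_singleton_eq_self he] at h1
      exact h1 (conn_src_of_sameCycle h)
    rw [tourPerm_insert he]
    refine ⟨fun z => (ih1 z).mul_swap hd, fun z hz => ?_⟩
    rcases hz with hz | hz
    · have := Equiv.Perm.sameCycle_mul_swap hd
      rcases (G.edge_eq_iff _ _).1 hz with h | h
      · subst h
        exact this
      · subst h
        rw [G.rev_rev] at this ⊢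
        exact this.symm
    · exact (ih2 z hz).mul_swap hd

theorem sameCycle_tourPerm [Finite D] [Finite E] (T : G.SpanningTree) (a b : D) :
    (G.tourPerm T.1).SameCycle a b := by
  obtain ⟨h1, h2⟩ := sameCycle_tourPerm_of_not_hasCycle (Set.toFinite T.1) T.2.2
  have hsrc : ∀ a b, G.src a = G.src b → (G.tourPerm T.1).SameCycle a b := fun a b hab =>
    (G.next_cyclic a b hab).of_forall_rel (Equiv.Perm.sameCycle_equivalence _) h1
  have key : ∀ u w, G.Conn T.1 u w → ∀ a b, G.src a = u → G.src b = w →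
      (G.tourPerm T.1).SameCycle a b := by
    intro u w h
    induction h with
    | refl => exact fun a b ha hb => hsrc a b (ha.trans hb.symm)
    | tail _ hd ih =>
      obtain ⟨d, hd, rfl, rfl⟩ := hd
      exact fun a b ha hb => ((ih a d ha rfl).trans (h2 d hd)).trans (hsrc _ _ hb.symm)
  exact key _ _ (T.2.1 _ _) a b rfl rfl

theorem tour_zero (d : D) (T : Set E) : G.tour d T 0 = d := rfl

theorem tour_succ (d : D) (T : Set E) (n : ℕ) :
    G.tour d T (n + 1) = G.tourStep T (G.tour d T n) := Function.iterate_succ_apply' _ _ _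

theorem tour_tourStep (d : D) (T : Set E) (n : ℕ) :
    G.tour (G.tourStep T d) T n = G.tour d T (n + 1) := (Function.iterate_succ_apply _ _ _).symm

theorem tour_eq_pow (d : D) (T : Set E) (n : ℕ) : G.tour d T n = (G.tourPerm T ^ n) d := by
  induction n with
  | zero => rfl
  | succ n ih => rw [tour_succ, ih, pow_succ', Equiv.Perm.mul_apply, tourPerm_apply]

section

variable [Fintype D] [Finite E]

theorem isCycleOn_tourPerm (T : G.SpanningTree) :
    (G.tourPerm T.1).IsCycleOn ((Finset.univ : Finset D) : Set D) := by
  rw [Finset.coe_univ]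
  exact ⟨Set.bijOn_univ.2 (G.tourPerm T.1).bijective, fun a _ b _ => sameCycle_tourPerm T a b⟩

theorem exists_tour_eq (T : G.SpanningTree) (d x : D) :
    ∃ n < Fintype.card D, G.tour d T.1 n = x := by
  obtain ⟨n, hn, h⟩ := (isCycleOn_tourPerm T).exists_pow_eq (Finset.mem_univ d)
    (Finset.mem_univ x)
  exact ⟨n, hn, by rw [tour_eq_pow, h]⟩

theorem tour_injective (T : G.SpanningTree) (d : D) {m n : ℕ} (hm : m < Fintype.card D)
    (hn : n < Fintype.card D) (h : G.tour d T.1 m = G.tour d T.1 n) : m = n := by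
  rw [tour_eq_pow, tour_eq_pow,
    (isCycleOn_tourPerm T).pow_apply_eq_pow_apply (Finset.mem_univ d)] at h
  exact Nat.ModEq.eq_of_lt_of_lt h hm hn

/-- Crossing the fundamental cut of a tree edge: the tour visits the far side of the edge between
the two times when it walks along this edge. -/
theorem conn_tour_iff (T : G.SpanningTree) (d : D) {s t : ℕ} (hst : s < t)
    (ht : t < Fintype.card D) (hrev : G.tour d T.1 t = G.rev (G.tour d T.1 s))
    (hmem : G.edge (G.tour d T.1 s) ∈ T.1) {i : ℕ} (hi : i < Fintype.card D) :
    G.Conn (T.1 \ {G.edge (G.tour d T.1 s)}) (G.tgt (G.tour d T.1 s))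
      (G.src (G.tour d T.1 i)) ↔ s < i ∧ i ≤ t := by
  set x := G.tour d T.1 s with hx
  have hnc := not_conn_diff_of_not_hasCycle T.2.2 hmem
  set P : D → Prop := fun y => G.Conn (T.1 \ {G.edge x}) (G.tgt x) (G.src y) with hP
  change P (G.tour d T.1 i) ↔ _
  have hPx : ¬ P x := fun h => hnc h.symm
  have hPr : P (G.rev x) := Conn.refl _ _
  -- Only walking along x or its reverse crosses the fundamental cut; each occurs once per period,
  -- at times s and t.
  have hstep : ∀ y, y ≠ x → y ≠ G.rev x → (P (G.tourStep T.1 y) ↔ P y) := by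
    intro y h1 h2
    simp only [hP]
    by_cases hy : G.edge y ∈ T.1
    · rw [src_tourStep_of_mem hy]
      have : G.Conn (T.1 \ {G.edge x}) (G.src y) (G.tgt y) := Conn.dart ⟨hy, fun he => by
        rcases (G.edge_eq_iff _ _).1 (Eq.symm he) with h | h
        · exact h1 h
        · exact h2 h⟩
      exact ⟨fun h => h.trans this.symm, fun h => h.trans this⟩
    · rw [src_tourStep_of_notMem hy]
  have hne : ∀ j, j < Fintype.card D → j ≠ s → j ≠ t →
      (P (G.tour d T.1 (j + 1)) ↔ P (G.tour d T.1 j)) := by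
    intro j hj h1 h2
    rw [tour_succ]
    refine hstep _ (fun h => h1 ?_) (fun h => h2 ?_)
    · exact tour_injective T d hj (hst.trans ht) h
    · exact tour_injective T d hj ht (h.trans hrev.symm)
  have hlow : ∀ k ≤ s, ¬ P (G.tour d T.1 (s - k)) := by
    intro k
    induction k with
    | zero => intro _; exact hPx
    | succ k ih =>
      intro hk
      have := hne (s - (k + 1)) (by omega) (by omega) (by omega)
      rw [show s - (k + 1) + 1 = s - k by omega] at this
      rw [← this]
      exact ih (by omega)
  have hmid : ∀ k, s + 1 + k ≤ t → P (G.tour d T.1 (s + 1 + k)) := by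
    intro k
    induction k with
    | zero =>
      intro _
      rw [add_zero, tour_succ, ← hx]
      simp only [hP, src_tourStep_of_mem hmem]
      exact Conn.refl _ _
    | succ k ih =>
      intro hk
      rw [show s + 1 + (k + 1) = s + 1 + k + 1 by omega,
        hne (s + 1 + k) (by omega) (by omega) (by omega)]
      exact ih (by omega)
  have hhigh : ∀ k, t + 1 + k < Fintype.card D → ¬ P (G.tour d T.1 (t + 1 + k)) := by
    intro k
    induction k with
    | zero =>
      intro _
      rw [add_zero, tour_succ, hrev]
      simp only [hP]
      rw [src_tourStep_of_mem (by rwa [G.edge_rev]), G.tgt_rev]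
      exact fun h => hnc h.symm
    | succ k ih =>
      intro hk
      rw [show t + 1 + (k + 1) = t + 1 + k + 1 by omega,
        hne (t + 1 + k) (by omega) (by omega) (by omega)]
      exact ih (by omega)
  rcases Nat.lt_or_ge s i with h | h
  · rcases Nat.lt_or_ge t i with h' | h'
    · refine iff_of_false ?_ (by omega)
      have := hhigh (i - (t + 1)) (by omega)
      rwa [show t + 1 + (i - (t + 1)) = i by omega] at this
    · refine iff_of_true ?_ (by omega)
      have := hmid (i - (s + 1)) (by omega)
      rwa [show s + 1 + (i - (s + 1)) = i by omega] at this
  · refine iff_of_false ?_ (by omega)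
    have := hlow (s - i) (by omega)
    rwa [show s - (s - i) = i by omega] at this

theorem exists_first (T : G.SpanningTree) (d : D) (e : E) :
    ∃ n < Fintype.card D, G.edge (G.tour d T.1 n) = e ∧
      (∀ m < n, G.edge (G.tour d T.1 m) ≠ e) ∧
      G.firstVertex d T.1 e = G.src (G.tour d T.1 n) := by
  classical
  obtain ⟨x, rfl⟩ := G.edge_surjective e
  obtain ⟨k, hk, hkx⟩ := exists_tour_eq T d x
  have hne : {n | G.edge (G.tour d T.1 n) = G.edge x}.Nonempty := ⟨k, by simp [hkx]⟩
  refine ⟨sInf {n | G.edge (G.tour d T.1 n) = G.edge x}, ?_, Nat.sInf_mem hne,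
    fun m hm => Nat.notMem_of_lt_sInf hm, rfl⟩
  exact lt_of_le_of_lt (Nat.sInf_le (by simp [hkx])) hk

end

theorem firstVertex_eq {d : D} {T : Set E} {n : ℕ} {e : E} (h : G.edge (G.tour d T n) = e)
    (hmin : ∀ m < n, G.edge (G.tour d T m) ≠ e) :
    G.firstVertex d T e = G.src (G.tour d T n) := by
  rw [firstVertex]
  congr 2
  refine le_antisymm (Nat.sInf_le h) (le_csInf ⟨n, h⟩ fun m hm => ?_)
  by_contra hlt
  exact hmin m (by omega) hm

/-! ### Bijectivity of the Bernardi map. -/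

section

variable [Fintype V] [Fintype E] [Fintype D]

theorem bernardi_mem_breakDivisors (d : D) (T : G.SpanningTree) :
    G.bernardi d T ∈ G.breakDivisors := by
  refine ⟨T, G.firstVertex d T.1, fun e _ => ?_, rfl⟩
  obtain ⟨n, -, hn, -, h⟩ := exists_first T d e
  exact ⟨_, hn, h.symm⟩

open Classical in
/-- Two trees whose tours start in the same way, until the first one walks along an edge which the
second one cuts, have different Bernardi divisors. -/
theorem bernardi_ne (d : D) (T₁ T₂ : G.SpanningTree) {s : ℕ} (hs : s < Fintype.card D)
    (hagree : ∀ m < s, (G.edge (G.tour d T₁.1 m) ∈ T₁.1 ↔ G.edge (G.tour d T₁.1 m) ∈ T₂.1))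
    (h₁ : G.edge (G.tour d T₁.1 s) ∈ T₁.1) (h₂ : G.edge (G.tour d T₁.1 s) ∉ T₂.1) :
    G.bernardi d T₁ ≠ G.bernardi d T₂ := by
  intro heq
  have htour : ∀ m ≤ s, G.tour d T₂.1 m = G.tour d T₁.1 m := by
    intro m
    induction m with
    | zero => intro _; rfl
    | succ m ih =>
      intro hm
      rw [tour_succ, tour_succ, ih (by omega), tourStep, tourStep]
      simp only [hagree m (by omega)]
  set x := G.tour d T₁.1 s with hx
  have hnew : ∀ m < s, G.edge (G.tour d T₁.1 m) ≠ G.edge x := by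
    intro m hm he
    have := hagree m hm
    rw [he] at this
    exact h₂ (this.1 h₁)
  obtain ⟨t, ht, htx⟩ := exists_tour_eq T₁ d (G.rev x)
  have hst : s < t := by
    rcases Nat.lt_trichotomy s t with h | h | h
    · exact h
    · rw [← h] at htx
      exact absurd htx.symm (G.rev_ne x)
    · exact absurd (by rw [htx, G.edge_rev]) (hnew t h)
  have hB : ∀ i < Fintype.card D, G.Conn (T₁.1 \ {G.edge x}) (G.tgt x)
      (G.src (G.tour d T₁.1 i)) ↔ s < i ∧ i ≤ t := fun i hi =>
    conn_tour_iff T₁ d hst ht htx h₁ hi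
  -- A is the near side of the fundamental cut of x in T₁. The second divisor is shown to have
  -- larger degree on A.
  set A : Finset V := Finset.univ.filter fun v => ¬ G.Conn (T₁.1 \ {G.edge x}) (G.tgt x) v
    with hA
  have hmemA : ∀ v, v ∈ A ↔ ¬ G.Conn (T₁.1 \ {G.edge x}) (G.tgt x) v := by simp [hA]
  have hAtour : ∀ i < Fintype.card D, G.src (G.tour d T₁.1 i) ∈ A ↔ ¬ (s < i ∧ i ≤ t) :=
    fun i hi => by rw [hmemA, hB i hi]
  have hxA : G.src x ∈ A := by rw [hAtour s hs]; omega
  have hxA' : G.tgt x ∉ A := by rw [hmemA, not_not]; exact Conn.refl _ _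
  let W : G.SpanningTree → Finset E := fun T => Finset.univ.filter fun e =>
    e ∉ T.1 ∧ e ∉ G.inner A ∧ G.firstVertex d T.1 e ∈ A
  have hsum : ∀ T : G.SpanningTree, ∑ v ∈ A, G.bernardi d T v =
      ((G.inner A \ T.1.toFinset).card : ℤ) + (W T).card := by
    intro T
    rw [bernardi, sum_chipDivisor, ← Nat.cast_add, ← Finset.card_union_of_disjoint]
    · congr 2
      ext e
      simp only [Finset.mem_filter, Finset.mem_univ, true_and, Finset.mem_union,
        Finset.mem_sdiff, Set.mem_toFinset, W]
      obtain ⟨n, -, hn, -, h⟩ := exists_first T d e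
      have : e ∈ G.inner A → G.firstVertex d T.1 e ∈ A := fun he =>
        mem_of_isEndpoint he ⟨_, hn, h.symm⟩
      tauto
    · rw [Finset.disjoint_left]
      intro e he he'
      exact (Finset.mem_filter.1 he').2.2.1 (Finset.mem_sdiff.1 he).1
  -- A cut edge outside T₁ is met from the far side during (s, t]. If first met from A, it is met
  -- before time s, where both tours agree. The edge of x is a further member of W T₂.
  have hW : W T₁ ⊆ (W T₂).erase (G.edge x) := by
    intro e he
    simp only [W, Finset.mem_filter, Finset.mem_univ, true_and] at he
    obtain ⟨he1, he2, he3⟩ := he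
    obtain ⟨n, hn, hne, hmin, hfv⟩ := exists_first T₁ d e
    subst hne
    rw [hfv] at he3
    have htgt : G.tgt (G.tour d T₁.1 n) ∉ A := fun h => he2 (edge_mem_inner.2 ⟨he3, h⟩)
    obtain ⟨k, hk, hkr⟩ := exists_tour_eq T₁ d (G.rev (G.tour d T₁.1 n))
    rw [← G.src_rev, ← hkr, hAtour k hk] at htgt
    rw [hAtour n hn] at he3
    have hnk : n ≤ k := by
      by_contra h
      exact hmin k (by omega) (by rw [hkr, G.edge_rev])
    have hns : n < s := by
      rcases Nat.lt_trichotomy n s with h | h | h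
      · exact h
      · rw [h] at he1; exact absurd h₁ he1
      · omega
    have hT₂ : G.edge (G.tour d T₁.1 n) ∉ T₂.1 := fun h => he1 ((hagree n hns).2 h)
    rw [Finset.mem_erase]
    refine ⟨hnew n hns, ?_⟩
    simp only [W, Finset.mem_filter, Finset.mem_univ, true_and]
    refine ⟨hT₂, he2, ?_⟩
    rw [firstVertex_eq (n := n) (by rw [htour n hns.le]) fun m hm => by
      rw [htour m (by omega)]; exact hmin m hm, htour n hns.le, hAtour n hn]
    omega
  have hxW : G.edge x ∈ W T₂ := by
    simp only [W, Finset.mem_filter, Finset.mem_univ, true_and]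
    refine ⟨h₂, fun h => hxA' (edge_mem_inner.1 h).2, ?_⟩
    rw [firstVertex_eq (n := s) (by rw [htour s le_rfl]) fun m hm => by
      rw [htour m hm.le]; exact hnew m hm, htour s le_rfl]
    exact hxA
  have hWcard : (W T₁).card + 1 ≤ (W T₂).card := by
    rw [← Finset.card_erase_add_one hxW]
    exact Nat.succ_le_succ (Finset.card_le_card hW)
  -- T₁ has the maximal number of edges inside A, so T₂ leaves at least as many edges inside A
  -- uncovered.
  have hAB : (G.inner A ∩ T₁.1.toFinset).card + 1 = A.card := by
    have e1 := T₁.card_inner_add_one_le A ⟨_, hxA⟩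
    have e2 := T₁.card_inner_add_one_le Aᶜ ⟨G.tgt x, by simpa using hxA'⟩
    have e3 := T₁.card_add_one
    have e4 := Finset.card_add_card_compl A
    have e5 : T₁.1.toFinset ⊆ insert (G.edge x)
        ((G.inner A ∩ T₁.1.toFinset) ∪ (G.inner Aᶜ ∩ T₁.1.toFinset)) := by
      intro e he
      obtain ⟨y, rfl⟩ := G.edge_surjective e
      simp only [Finset.mem_insert, Finset.mem_union, Finset.mem_inter, he, and_true,
        edge_mem_inner, Finset.mem_compl]
      by_cases hyx : G.edge y = G.edge x
      · exact Or.inl hyx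
      right
      have hc : G.Conn (T₁.1 \ {G.edge x}) (G.src y) (G.tgt y) :=
        Conn.dart ⟨by simpa using he, hyx⟩
      rw [hmemA, hmemA]
      by_cases h : G.Conn (T₁.1 \ {G.edge x}) (G.tgt x) (G.src y)
      · exact Or.inr ⟨fun h' => h' h, fun h' => h' (h.trans hc)⟩
      · exact Or.inl ⟨h, fun h' => h (h'.trans hc.symm)⟩
    have e6 := Finset.card_le_card e5
    have e7 := Finset.card_insert_le (G.edge x)
      ((G.inner A ∩ T₁.1.toFinset) ∪ (G.inner Aᶜ ∩ T₁.1.toFinset))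
    have e8 := Finset.card_union_le (G.inner A ∩ T₁.1.toFinset) (G.inner Aᶜ ∩ T₁.1.toFinset)
    omega
  have e1 := T₂.card_inner_add_one_le A ⟨_, hxA⟩
  have e2 := Finset.card_sdiff_add_card_inter (G.inner A) T₁.1.toFinset
  have e3 := Finset.card_sdiff_add_card_inter (G.inner A) T₂.1.toFinset
  have e4 := hsum T₁
  rw [heq, hsum T₂] at e4
  omega

theorem bernardi_injective (d : D) : Function.Injective (G.bernardi d) := by
  classical
  intro T₁ T₂ heq
  by_contra hne
  have hex : ∃ n, n < Fintype.card D ∧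
      ¬ (G.edge (G.tour d T₁.1 n) ∈ T₁.1 ↔ G.edge (G.tour d T₁.1 n) ∈ T₂.1) := by
    by_contra hno
    push Not at hno
    refine hne (Subtype.ext (Set.ext fun e => ?_))
    obtain ⟨x, rfl⟩ := G.edge_surjective e
    obtain ⟨n, hn, rfl⟩ := exists_tour_eq T₁ d x
    exact hno n hn
  obtain ⟨hs, hns⟩ := Nat.find_spec hex
  have hmin : ∀ m < Nat.find hex,
      (G.edge (G.tour d T₁.1 m) ∈ T₁.1 ↔ G.edge (G.tour d T₁.1 m) ∈ T₂.1) := fun m hm => by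
    by_contra h
    exact Nat.find_min hex hm ⟨by omega, h⟩
  set s := Nat.find hex
  by_cases h₁ : G.edge (G.tour d T₁.1 s) ∈ T₁.1
  · exact bernardi_ne d T₁ T₂ hs hmin h₁ (fun h => hns (iff_of_true h₁ h)) heq
  · have h₂ : G.edge (G.tour d T₁.1 s) ∈ T₂.1 := by
      by_contra h
      exact hns (iff_of_false h₁ h)
    have htour : ∀ m ≤ s, G.tour d T₂.1 m = G.tour d T₁.1 m := by
      intro m
      induction m with
      | zero => intro _; rfl
      | succ m ih =>
        intro hm
        rw [tour_succ, tour_succ, ih (by omega), tourStep, tourStep]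
        simp only [hmin m (by omega)]
    refine bernardi_ne d T₂ T₁ hs (fun m hm => ?_) ?_ ?_ heq.symm
    · rw [htour m hm.le]; exact (hmin m hm).symm
    · rwa [htour s le_rfl]
    · rwa [htour s le_rfl]

/-- The Bernardi map is onto the divisors which satisfy the inequalities of a break divisor. -/
theorem exists_bernardi_eq (d : D) {F : V → ℤ} (hF : G.IsBreakMod ∅ ∅ F) :
    ∃ T, G.bernardi d T = F := by
  classical
  have := Fintype.ofFinite G.SpanningTree
  by_contra hno
  -- A missed divisor, together with the image, would be one more solution of the inequalities than
  -- there are trees.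
  have h := card_le_card_spanningTree (G := G.toLooplessMultigraph)
    (insert F (Finset.univ.image (G.bernardi d))) fun F' hF' => by
      rcases Finset.mem_insert.1 hF' with rfl | h
      · exact hF
      · obtain ⟨T, -, rfl⟩ := Finset.mem_image.1 h
        exact isBreakMod_of_mem_breakDivisors (bernardi_mem_breakDivisors d T)
  rw [Finset.card_insert_of_notMem (by simpa using hno),
    Finset.card_image_of_injective _ (bernardi_injective d), Finset.card_univ,
    Nat.card_eq_fintype_card] at h
  omega

theorem bijOn_bernardi (d : D) : Set.BijOn (G.bernardi d) Set.univ G.breakDivisors :=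
  ⟨fun T _ => bernardi_mem_breakDivisors d T, (bernardi_injective d).injOn, fun F hF => by
    obtain ⟨T, rfl⟩ := exists_bernardi_eq d (isBreakMod_of_mem_breakDivisors hF)
    exact ⟨T, Set.mem_univ _, rfl⟩⟩

end

end RibbonGraph

/-! ### Changing the initial data. -/

namespace RibbonGraph

variable {V E D : Type*} {G : RibbonGraph V E D}

section

variable [Finite E] [Fintype D]

theorem firstVertex_tourStep_of_ne (T : G.SpanningTree) {d : D} {e : E} (he : e ≠ G.edge d) :
    G.firstVertex (G.tourStep T.1 d) T.1 e = G.firstVertex d T.1 e := by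
  obtain ⟨n, -, hn, hmin, h⟩ := exists_first T d e
  obtain _ | k := n
  · exact absurd hn.symm he
  rw [h, ← tour_tourStep]
  refine firstVertex_eq (by rwa [tour_tourStep]) fun m hm => ?_
  rw [tour_tourStep]
  exact hmin _ (by omega)

theorem firstVertex_self (T : Set E) (d : D) : G.firstVertex d T (G.edge d) = G.src d :=
  firstVertex_eq (n := 0) rfl (by simp)

theorem firstVertex_tourStep_self (T : G.SpanningTree) (d : D) :
    G.firstVertex (G.tourStep T.1 d) T.1 (G.edge d) = G.tgt d := by
  obtain ⟨t, ht, htd⟩ := exists_tour_eq T d (G.rev d)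
  obtain _ | k := t
  · exact absurd htd.symm (G.rev_ne d)
  rw [← G.src_rev, ← htd, ← tour_tourStep]
  refine firstVertex_eq (by rw [tour_tourStep, htd, G.edge_rev]) fun m hm => ?_
  rw [tour_tourStep]
  intro he
  rcases (G.edge_eq_iff _ _).1 he.symm with h | h
  · have := tour_injective T d (m := m + 1) (n := 0) (by omega) (by omega) h
    omega
  · have := tour_injective T d (m := m + 1) (n := k + 1) (by omega) ht (h.trans htd.symm)
    omega

end

open Classical in
/-- The boundary of a directed edge. -/
noncomputable def bdry (G : RibbonGraph V E D) (d : D) : V → ℤ :=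
  Pi.single (G.tgt d) 1 - Pi.single (G.src d) 1

theorem bdry_rev (d : D) : G.bdry (G.rev d) = -G.bdry d := by
  rw [bdry, bdry, G.src_rev, G.tgt_rev, neg_sub]

open Classical in
/-- The boundary of a directed edge outside `T`, and zero for an edge in `T`. -/
noncomputable def bdryOff (G : RibbonGraph V E D) (T : Set E) (d : D) : V → ℤ :=
  if G.edge d ∈ T then 0 else G.bdry d

variable [Fintype V] [Fintype E] [Fintype D]

/-- Starting one step later moves d to the end of the tour; only the chip of its edge can move, from
source to target. -/
theorem bernardi_tourStep (T : G.SpanningTree) (d : D) :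
    G.bernardi (G.tourStep T.1 d) T = G.bernardi d T + G.bdryOff T.1 d := by
  classical
  rw [← sub_eq_iff_eq_add', bernardi, bernardi, chipDivisor, chipDivisor,
    ← Finset.sum_sub_distrib, bdryOff]
  split_ifs with hd
  · refine Finset.sum_eq_zero fun e he => ?_
    rw [firstVertex_tourStep_of_ne, sub_self]
    rintro rfl
    exact (Finset.mem_filter.1 he).2 hd
  · rw [Finset.sum_eq_single (G.edge d)]
    · rw [firstVertex_self, firstVertex_tourStep_self, bdry]
    · intro e _ he
      rw [firstVertex_tourStep_of_ne T he, sub_self]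
    · intro h
      exact absurd (by simp [hd]) h

theorem bernardi_tour (T : G.SpanningTree) (d : D) (k : ℕ) :
    G.bernardi (G.tour d T.1 k) T =
      G.bernardi d T + ∑ i ∈ Finset.range k, G.bdryOff T.1 (G.tour d T.1 i) := by
  induction k with
  | zero => simp [tour_zero]
  | succ k ih => rw [tour_succ, bernardi_tourStep, ih, Finset.sum_range_succ, add_assoc]

-- Edges inside B cancel between their two directions, so what remains is the effect of firing B.
open Classical in
theorem sum_bdry (B : Set V) :
    ∑ d with G.src d ∈ B, G.bdry d = -G.laplacian fun v => if v ∈ B then 1 else 0 := by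
  ext v
  have h1 : ∑ d, (if G.src d = v then (if G.tgt d ∈ B then 1 else 0 : ℤ) else 0) =
      ∑ d, if G.tgt d = v then (if G.src d ∈ B then 1 else 0 : ℤ) else 0 := by
    rw [← sum_rev (G := G.toLooplessMultigraph)]
    simp only [G.src_rev, G.tgt_rev]
  simp only [laplacian, AddMonoidHom.coe_mk, ZeroHom.coe_mk, Pi.neg_apply, Finset.sum_apply,
    Finset.sum_filter, bdry, Pi.sub_apply, Pi.single_apply]
  rw [eq_neg_iff_add_eq_zero, ← Finset.sum_add_distrib, ← sub_eq_zero.2 h1.symm,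
    ← Finset.sum_sub_distrib]
  refine Finset.sum_congr rfl fun d _ => ?_
  by_cases h1 : G.src d = v <;> by_cases h2 : G.tgt d = v <;> by_cases h3 : G.src d ∈ B <;>
    by_cases h4 : G.tgt d ∈ B <;> simp [h1, h2, h3, h4, eq_comm (a := v)] <;> simp_all

theorem cls_laplacian (f : V → ℤ) : G.cls (G.laplacian f) = 0 := by
  rw [cls, QuotientAddGroup.eq_zero_iff]
  exact ⟨f, rfl⟩

theorem cls_add (F F' : V → ℤ) : G.cls (F + F') = G.cls F + G.cls F' := rfl

theorem sum_bdry_eq_zero (S : Finset D) (hS : ∀ d ∈ S, G.rev d ∈ S) : ∑ d ∈ S, G.bdry d = 0 :=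
  Finset.sum_involution (fun d _ => G.rev d) (fun d _ => by rw [bdry_rev, add_neg_cancel])
    (fun d _ _ => G.rev_ne d) hS (fun d _ => G.rev_rev d)

-- Turning past a tree edge amounts to touring the whole far side B. Up to the reverse of d, the
-- chip moves add up to firing B, a principal divisor that disappears in the class.
open Classical in
theorem cls_bernardi_next_of_mem (T : G.SpanningTree) {d : D} (hd : G.edge d ∈ T.1) :
    G.cls (G.bernardi (G.next d) T) = G.cls (G.bernardi d T) + G.cls (G.bdry d) := by
  obtain ⟨t, ht, htd⟩ := exists_tour_eq T d (G.rev d)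
  have ht0 : 0 < t := by
    rcases Nat.eq_zero_or_pos t with rfl | h
    · exact absurd htd.symm (G.rev_ne d)
    · exact h
  have hnext : G.next d = G.tour d T.1 (t + 1) := by
    rw [tour_succ, htd, tourStep_of_mem (by rwa [G.edge_rev]), G.rev_rev]
  set B : Set V := {v | G.Conn (T.1 \ {G.edge d}) (G.tgt d) v} with hB
  have hiff : ∀ i < Fintype.card D, G.src (G.tour d T.1 i) ∈ B ↔ 0 < i ∧ i ≤ t := fun i hi =>
    conn_tour_iff T d ht0 ht htd hd hi
  have hsum1 : ∑ i ∈ Finset.range (t + 1), G.bdryOff T.1 (G.tour d T.1 i) =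
      ∑ y with G.src y ∈ B, G.bdryOff T.1 y := by
    have h0 : G.bdryOff T.1 (G.tour d T.1 0) = 0 := by rw [tour_zero, bdryOff, if_pos hd]
    rw [Finset.range_eq_Ico, Finset.sum_eq_sum_Ico_succ_bot (by omega), h0, zero_add]
    refine Finset.sum_bij (fun i _ => G.tour d T.1 i) ?_ ?_ ?_ ?_
    · intro i hi
      rw [Finset.mem_Ico] at hi
      simp only [Finset.mem_filter, Finset.mem_univ, true_and]
      rw [hiff i (by omega)]
      omega
    · intro i hi j hj h
      rw [Finset.mem_Ico] at hi hj
      exact tour_injective T d (by omega) (by omega) h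
    · intro y hy
      obtain ⟨i, hi, rfl⟩ := exists_tour_eq T d y
      simp only [Finset.mem_filter, Finset.mem_univ, true_and] at hy
      rw [hiff i hi] at hy
      exact ⟨i, by rw [Finset.mem_Ico]; omega, rfl⟩
    · intro i _
      rfl
  have hrevB : G.src (G.rev d) ∈ B := Conn.refl _ _
  have hsum2 : ∑ y with G.src y ∈ B, G.bdryOff T.1 y =
      (∑ y with G.src y ∈ B, G.bdry y) + G.bdry d := by
    -- Tree edges inside B cancel in opposite pairs; the only tree edge leaving B is the reverse of
    -- d.
    have hsplit : ∑ y with G.src y ∈ B ∧ G.edge y ∈ T.1, G.bdry y = -G.bdry d := by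
      rw [← bdry_rev, ← Finset.add_sum_erase _ _ (a := G.rev d)
        (by simp only [Finset.mem_filter, Finset.mem_univ, true_and]
            exact ⟨hrevB, by rwa [G.edge_rev]⟩)]
      rw [add_eq_left]
      refine sum_bdry_eq_zero _ fun y hy => ?_
      simp only [Finset.mem_erase, Finset.mem_filter, Finset.mem_univ, true_and] at hy ⊢
      obtain ⟨hyd, hyB, hyT⟩ := hy
      have hyd' : y ≠ d := by
        rintro rfl
        exact not_conn_diff_of_not_hasCycle T.2.2 hd (Conn.symm hyB)
      have hne : G.edge y ≠ G.edge d := fun he => by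
        rcases (G.edge_eq_iff _ _).1 he.symm with h | h
        · exact hyd' h
        · exact hyd h
      refine ⟨fun h => hyd' ?_, ?_, by rwa [G.edge_rev]⟩
      · rw [← G.rev_rev y, h, G.rev_rev]
      · exact Conn.trans hyB (Conn.dart ⟨hyT, hne⟩)
    have hsplit' := Finset.sum_filter_add_sum_filter_not
      (Finset.univ.filter fun y => G.src y ∈ B) (fun y => G.edge y ∈ T.1) G.bdry
    rw [Finset.filter_filter, hsplit] at hsplit'
    rw [← hsplit', neg_add_eq_sub, sub_add_cancel, Finset.sum_filter (fun y => G.edge y ∉ T.1)]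
    refine Finset.sum_congr rfl fun y _ => ?_
    rw [bdryOff, ite_not]
  rw [hnext, bernardi_tour, hsum1, hsum2, sum_bdry, cls_add, cls_add, ← map_neg, cls_laplacian,
    zero_add]

/-- Rotating the starting edge around its vertex changes the class of the Bernardi divisor by
an amount which does not depend on the tree. -/
theorem cls_bernardi_next (T : G.SpanningTree) (d : D) :
    G.cls (G.bernardi (G.next d) T) = G.cls (G.bernardi d T) + G.cls (G.bdry d) := by
  by_cases hd : G.edge d ∈ T.1
  · exact cls_bernardi_next_of_mem T hd
  · rw [← tourStep_of_notMem hd, bernardi_tourStep, bdryOff, if_neg hd, cls_add]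

/-! ### Planarity: non-tree edges do not cross. -/

section Planar

theorem numCycles_tourPerm_union_le (T : Set E) (U : Finset E)
    (hU : ∀ e ∈ U, e ∉ T) :
    (G.tourPerm (T ∪ U)).numCycles ≤ (G.tourPerm T).numCycles + U.card := by
  classical
  induction U using Finset.induction_on with
  | empty => simp
  | @insert e U he ih =>
    obtain ⟨d, rfl⟩ := G.edge_surjective e
    have hd : G.edge d ∉ T ∪ U := by
      rintro (h | h)
      · exact hU _ (Finset.mem_insert_self _ _) h
      · exact he h
    rw [Finset.coe_insert, Set.union_insert, tourPerm_insert hd, Finset.card_insert_of_notMem he]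
    have h1 := Equiv.Perm.numCycles_mul_swap_le (G.tourPerm (T ∪ U)) d (G.rev d)
    have h2 := ih fun e he => hU e (Finset.mem_insert_of_mem he)
    omega

theorem numCycles_tourPerm_le_one (T : G.SpanningTree) : (G.tourPerm T.1).numCycles ≤ 1 := by
  rw [Equiv.Perm.numCycles, Finite.card_le_one_iff_subsingleton]
  refine ⟨?_⟩
  rintro ⟨a⟩ ⟨b⟩
  exact Quotient.sound (sameCycle_tourPerm T a b)

theorem exists_src_eq [Nonempty D] (v : V) : ∃ d, G.src d = v := by
  obtain ⟨d⟩ := ‹Nonempty D›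
  rcases (G.connected (G.src d) v).cases_tail with h | ⟨w, -, d', -, rfl⟩
  · exact ⟨d, h.symm⟩
  · exact ⟨_, rfl⟩

/-- Once there is an edge, connectedness rules out isolated vertices, and boundary components are
the orbits of the tour around all edges. -/
theorem card_boundaryComponent_le [Nonempty D] :
    Nat.card G.BoundaryComponent ≤ (G.tourPerm Set.univ).numCycles := by
  have hempty : IsEmpty {v : V // ∀ d, G.src d ≠ v} := ⟨fun ⟨v, hv⟩ => by
    obtain ⟨d, hd⟩ := exists_src_eq (G := G) v
    exact hv d hd⟩
  have : Finite (Quot fun d d' : D => d' = G.next (G.rev d)) :=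
    Finite.of_surjective _ Quot.mk_surjective
  rw [BoundaryComponent, Nat.card_sum, Nat.card_of_isEmpty (α := {v : V // ∀ d, G.src d ≠ v}),
    add_zero]
  refine Nat.card_le_card_of_surjective
    (Quotient.lift (s := Equiv.Perm.SameCycle.setoid (G.tourPerm Set.univ))
      (fun d => Quot.mk (fun d d' : D => d' = G.next (G.rev d)) d) fun a b hab => ?_) ?_
  · refine Equiv.Perm.SameCycle.of_forall_rel
      (r := fun a b => Quot.mk (fun d d' : D => d' = G.next (G.rev d)) a = Quot.mk _ b)
      ⟨fun _ => rfl, Eq.symm, Eq.trans⟩ (fun z => ?_) hab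
    exact Quot.sound (tourPerm_univ_apply z)
  · rintro ⟨d⟩
    exact ⟨Quotient.mk _ d, rfl⟩

/-- For a planar graph, adding two more edges to a tree splits the boundary twice. -/
theorem IsPlanar.sameCycle_rev (hG : G.IsPlanar) (T : G.SpanningTree) {d x : D}
    (hd : G.edge d ∉ T.1) (hx : G.edge x ∉ T.1) (hxd : G.edge x ≠ G.edge d) :
    (G.tourPerm (insert (G.edge d) T.1)).SameCycle x (G.rev x) := by
  classical
  by_contra hno
  have : Nonempty D := ⟨d⟩
  have hx' : G.edge x ∉ insert (G.edge d) T.1 := by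
    rintro (h | h)
    · exact hxd h
    · exact hx h
  -- If x did not split a cycle, two cycles at most would remain after adding d and x. The other #E
  -- - #V - 1 edges add at most one each, one short of the #E - #V + 2 boundary components.
  have h1 : (G.tourPerm (insert (G.edge x) (insert (G.edge d) T.1))).numCycles ≤ 2 := by
    rw [tourPerm_insert hx']
    refine (Equiv.Perm.numCycles_mul_swap_le_of_not_sameCycle hno).trans ?_
    rw [tourPerm_insert hd]
    have := Equiv.Perm.numCycles_mul_swap_le (G.tourPerm T.1) d (G.rev d)
    have := numCycles_tourPerm_le_one T
    omega
  set T' : Finset E := insert (G.edge x) (insert (G.edge d) T.1.toFinset) with hT'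
  have hT'coe : insert (G.edge x) (insert (G.edge d) T.1) = (T' : Set E) := by simp [hT']
  have hT'card : T'.card = T.1.toFinset.card + 2 := by
    rw [hT', Finset.card_insert_of_notMem (by simpa [hxd] using hx),
      Finset.card_insert_of_notMem (by simpa using hd)]
  have h2 := numCycles_tourPerm_union_le (G := G) (T' : Set E) T'ᶜ (by simp)
  have h3 : (T' : Set E) ∪ (T'ᶜ : Finset E) = Set.univ := by
    rw [Finset.coe_compl, Set.union_compl_self]
  rw [h3, ← hT'coe] at h2
  have h4 := card_boundaryComponent_le (G := G)
  have h5 := T.card_add_one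
  have h6 := Finset.card_add_card_compl T'
  have h7 : G.eulerChar = 2 - 2 * ((0 : ℕ) : ℤ) := hG
  rw [eulerChar, Nat.card_eq_fintype_card, Nat.card_eq_fintype_card] at h7
  omega

/-- Adding d closes the tour segment from time 1 to t into a cycle; by planarity this cycle contains
both directions of any non-tree edge or neither. -/
theorem IsPlanar.exists_tour_eq_rev (hG : G.IsPlanar) (T : G.SpanningTree) {d : D}
    (hd : G.edge d ∉ T.1) {t : ℕ} (ht : t < Fintype.card D) (htd : G.tour d T.1 t = G.rev d)
    {i : ℕ} (hi : i ≤ t) (hiT : G.edge (G.tour d T.1 i) ∉ T.1) :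
    ∃ j ≤ t, G.tour d T.1 j = G.rev (G.tour d T.1 i) := by
  set x := G.tour d T.1 i with hx
  by_cases hxd : G.edge x = G.edge d
  · rcases (G.edge_eq_iff _ _).1 hxd with h | h
    · exact ⟨t, le_rfl, by rw [htd, h]⟩
    · exact ⟨0, Nat.zero_le _, h⟩
  have hi0 : 1 ≤ i := by
    rcases Nat.eq_zero_or_pos i with rfl | h
    · exact absurd rfl hxd
    · exact h
  obtain ⟨n, -, hn⟩ := (hG.sameCycle_rev T hd hiT hxd).exists_pow_eq'
  have key : ∀ n : ℕ, ∃ j, 1 ≤ j ∧ j ≤ t ∧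
      (G.tourPerm (insert (G.edge d) T.1) ^ n) x = G.tour d T.1 j := by
    intro n
    induction n with
    | zero => exact ⟨i, hi0, hi, rfl⟩
    | succ n ih =>
      obtain ⟨j, hj1, hjt, hj⟩ := ih
      rw [pow_succ', Equiv.Perm.mul_apply, hj, tourPerm_apply]
      rcases hjt.lt_or_eq with hlt | rfl
      · refine ⟨j + 1, by omega, hlt, ?_⟩
        have hne : G.edge (G.tour d T.1 j) ≠ G.edge d := fun he => by
          rcases (G.edge_eq_iff _ _).1 he.symm with h | h
          · have := tour_injective T d (m := j) (n := 0) (by omega) (by omega) h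
            omega
          · have := tour_injective T d (m := j) (n := t) (by omega) ht (h.trans htd.symm)
            omega
        by_cases hT : G.edge (G.tour d T.1 j) ∈ T.1
        · rw [tour_succ, tourStep_of_mem hT, tourStep_of_mem (Set.mem_insert_of_mem _ hT)]
        · rw [tour_succ, tourStep_of_notMem hT,
            tourStep_of_notMem (fun h => h.elim hne hT)]
      · refine ⟨1, le_rfl, hj1, ?_⟩
        rw [htd, tourStep_of_mem (by rw [G.edge_rev]; exact Set.mem_insert _ _), G.rev_rev,
          tour_succ, tour_zero, tourStep_of_notMem hd]
  obtain ⟨j, -, hjt, hj⟩ := key n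
  exact ⟨j, hjt, by rw [← hj, hn]⟩

/-- For a planar graph, the Bernardi divisor does not change when the starting edge moves along
a boundary component. -/
theorem IsPlanar.bernardi_next_rev (hG : G.IsPlanar) (T : G.SpanningTree) (d : D) :
    G.bernardi (G.next (G.rev d)) T = G.bernardi d T := by
  classical
  by_cases hd : G.edge d ∈ T.1
  · rw [← tourStep_of_mem hd, bernardi_tourStep, bdryOff, if_pos hd, add_zero]
  obtain ⟨t, ht, htd⟩ := exists_tour_eq T d (G.rev d)
  have hnext : G.next (G.rev d) = G.tour d T.1 (t + 1) := by
    rw [tour_succ, htd, tourStep_of_notMem (by rwa [G.edge_rev])]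
  rw [hnext, bernardi_tour, add_eq_left]
  have hinj : Set.InjOn (fun i => G.tour d T.1 i) (Finset.range (t + 1)) := by
    intro i hi j hj h
    simp only [Finset.coe_range, Set.mem_Iio] at hi hj
    exact tour_injective T d (by omega) (by omega) h
  rw [← Finset.sum_image (f := G.bdryOff T.1) hinj]
  simp only [bdryOff]
  rw [← Finset.sum_filter_add_sum_filter_not _ fun y => G.edge y ∈ T.1]
  rw [Finset.sum_eq_zero (fun y hy => if_pos (Finset.mem_filter.1 hy).2), zero_add,
    Finset.sum_congr rfl (fun y hy => if_neg (Finset.mem_filter.1 hy).2)]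
  -- Both directions of each non-tree edge met between d and its reverse occur there, with opposite
  -- boundaries.
  refine sum_bdry_eq_zero _ fun y hy => ?_
  simp only [Finset.mem_filter, Finset.mem_image, Finset.mem_range] at hy ⊢
  obtain ⟨⟨i, hi, rfl⟩, hiT⟩ := hy
  obtain ⟨j, hj, hji⟩ := hG.exists_tour_eq_rev T hd ht htd (Nat.le_of_lt_succ hi) hiT
  exact ⟨⟨j, Nat.lt_succ_of_le hj, hji⟩, by rwa [G.edge_rev]⟩

end Planar

/-- The classes of the Bernardi divisors with initial data `d` and `d'` differ by an amount which
does not depend on the tree. -/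
def SameTorsor (G : RibbonGraph V E D) (d d' : D) : Prop :=
  ∃ c : G.Pic, ∀ T, G.cls (G.bernardi d' T) = G.cls (G.bernardi d T) + c

theorem sameTorsor_equivalence : Equivalence G.SameTorsor := by
  refine ⟨fun d => ⟨0, fun T => (add_zero _).symm⟩, ?_, ?_⟩
  · rintro d d' ⟨c, hc⟩
    exact ⟨-c, fun T => by rw [hc, add_neg_cancel_right]⟩
  · rintro d d' d'' ⟨c, hc⟩ ⟨c', hc'⟩
    exact ⟨c + c', fun T => by rw [hc', hc, add_assoc]⟩

theorem sameTorsor_next (d : D) : G.SameTorsor d (G.next d) :=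
  ⟨_, fun T => cls_bernardi_next T d⟩

theorem IsPlanar.sameTorsor (hG : G.IsPlanar) (d d' : D) : G.SameTorsor d d' := by
  have heq := sameTorsor_equivalence (G := G)
  have hsrc : ∀ a b, G.src a = G.src b → G.SameTorsor a b := fun a b hab =>
    (G.next_cyclic a b hab).of_forall_rel heq sameTorsor_next
  have hrev : ∀ a, G.SameTorsor a (G.rev a) := fun a =>
    heq.trans (y := G.next (G.rev a)) ⟨0, fun T => by rw [hG.bernardi_next_rev, add_zero]⟩
      (heq.symm (sameTorsor_next _))
  have key : ∀ w, Relation.ReflTransGen (fun x y => ∃ d, G.src d = x ∧ G.src (G.rev d) = y)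
      (G.src d) w → ∀ b, G.src b = w → G.SameTorsor d b := by
    intro w h
    induction h with
    | refl => exact fun b hb => hsrc d b hb.symm
    | tail _ hd ih =>
      obtain ⟨a, rfl, rfl⟩ := hd
      exact fun b hb => heq.trans (heq.trans (ih a rfl) (hrev a)) (hsrc _ _ hb.symm)
  exact key _ (G.connected _ _) d' rfl

end RibbonGraph

/-! ### Break divisors in each class and the resulting action. -/

namespace RibbonGraph

variable {V E D : Type*} {G : RibbonGraph V E D} [Fintype V] [Fintype E] [Fintype D]

theorem subsingleton_vert (G : RibbonGraph V E D) [IsEmpty D] : Subsingleton V := by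
  refine ⟨fun u w => ?_⟩
  rcases (G.connected u w).cases_head with h | ⟨_, ⟨d, -⟩, -⟩
  · exact h
  · exact isEmptyElim d

theorem isEmpty_edge (G : RibbonGraph V E D) [IsEmpty D] : IsEmpty E :=
  ⟨fun e => isEmptyElim (G.edge_surjective e).choose⟩

theorem nonempty_spanningTree_of_isBreakMod {F : V → ℤ} (hF : G.IsBreakMod ∅ ∅ F) :
    Nonempty G.SpanningTree := by
  have h := card_le_card_spanningTree (G := G.toLooplessMultigraph) {F} (by simpa using hF)
  rw [Finset.card_singleton] at h
  exact (Nat.card_pos_iff.1 (by omega)).1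

/-- Surjectivity of the Bernardi map gives this as soon as there is an initial edge; otherwise G is
a single vertex and F = 0. -/
theorem mem_breakDivisors_of_isBreakMod {F : V → ℤ} (hF : G.IsBreakMod ∅ ∅ F) :
    F ∈ G.breakDivisors := by
  classical
  rcases isEmpty_or_nonempty D with hD | ⟨⟨d⟩⟩
  · have := subsingleton_vert G
    have := isEmpty_edge G
    obtain ⟨T⟩ := nonempty_spanningTree_of_isBreakMod hF
    refine ⟨T, isEmptyElim, isEmptyElim, ?_⟩
    ext v
    have h := hF.sum_eq
    rw [Fintype.sum_subsingleton _ v, Fintype.card_eq_one_iff.2 ⟨v, fun _ => Subsingleton.elim _ _⟩]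
      at h
    simpa [chipDivisor] using h
  · obtain ⟨T, rfl⟩ := exists_bernardi_eq d hF
    exact bernardi_mem_breakDivisors d T

theorem degree_of_isBreakMod {F : V → ℤ} (hF : G.IsBreakMod ∅ ∅ F) : degree F = G.genus := by
  classical
  have h := hF.sum_eq
  rw [Finset.sdiff_empty, Finset.card_univ] at h
  exact h

/-- Every class of degree `g` contains exactly one break divisor. -/
theorem existsUnique_breakDivisor {c : G.Pic} (hc : c ∈ G.PicDeg G.genus) :
    ∃! F, F ∈ G.breakDivisors ∧ G.cls F = c := by
  obtain ⟨F, hF, rfl⟩ := hc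
  obtain ⟨f, hf⟩ := exists_isBreakMod_add_laplacian F hF
  refine ⟨F + G.laplacian f, ⟨mem_breakDivisors_of_isBreakMod hf, ?_⟩, ?_⟩
  · rw [cls_add, cls_laplacian, add_zero]
  · rintro F' ⟨hF', h⟩
    refine eq_of_isBreakMod_of_cls_eq (isBreakMod_of_mem_breakDivisors hF') hf ?_
    rw [h, cls_add, cls_laplacian, add_zero]

/-- The energy argument produces a solution of the inequalities, and there are at most as many
solutions as trees. -/
theorem nonempty_spanningTree : Nonempty G.SpanningTree := by
  classical
  obtain ⟨v⟩ := G.nonempty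
  obtain ⟨f, hf⟩ := exists_isBreakMod_add_laplacian (G := G.toLooplessMultigraph)
    (Pi.single v G.genus) (by simp [degree])
  exact nonempty_spanningTree_of_isBreakMod hf

theorem add_cls_mem_picDeg (γ : G.Pic0) {F : V → ℤ} (hF : F ∈ G.breakDivisors) :
    (γ : G.Pic) + G.cls F ∈ G.PicDeg G.genus := by
  obtain ⟨_, F₀, hF₀, rfl⟩ := γ
  refine ⟨F₀ + F, ?_, rfl⟩
  rw [map_add, degree_of_isBreakMod (isBreakMod_of_mem_breakDivisors hF),
    show degree F₀ = 0 from hF₀, zero_add]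

theorem translate_spec (γ : G.Pic0) {F : V → ℤ} (hF : F ∈ G.breakDivisors) :
    G.translate γ F ∈ G.breakDivisors ∧ G.cls (G.translate γ F) = γ + G.cls F := by
  have hex : ∃ F' ∈ G.breakDivisors, G.cls F' = (γ : G.Pic) + G.cls F :=
    (existsUnique_breakDivisor (add_cls_mem_picDeg γ hF)).exists
  rw [LooplessMultigraph.translate, dif_pos hex]
  exact hex.choose_spec

theorem cls_bernardi_bernardiAct (d : D) (γ : G.Pic0) (T : G.SpanningTree) :
    G.cls (G.bernardi d (G.bernardiAct d γ T)) = γ + G.cls (G.bernardi d T) := by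
  obtain ⟨h1, h2⟩ := translate_spec γ (bernardi_mem_breakDivisors d T)
  have hex : ∃ T', G.bernardi d T' = G.translate γ (G.bernardi d T) :=
    exists_bernardi_eq d (isBreakMod_of_mem_breakDivisors h1)
  rw [bernardiAct, dif_pos hex, hex.choose_spec, h2]

theorem cls_bernardi_injective (d : D) :
    Function.Injective fun T => G.cls (G.bernardi d T) := fun T T' h =>
  bernardi_injective d (eq_of_isBreakMod_of_cls_eq
    (isBreakMod_of_mem_breakDivisors (bernardi_mem_breakDivisors d T))
    (isBreakMod_of_mem_breakDivisors (bernardi_mem_breakDivisors d T')) h)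

/-- Translation by γ in Pic commutes with the constant shift between the two Bernardi classes. -/
theorem IsPlanar.bernardiAct_eq (hG : G.IsPlanar) (d d' : D) :
    G.bernardiAct d = G.bernardiAct d' := by
  obtain ⟨c, hc⟩ := hG.sameTorsor d d'
  ext1 γ
  ext1 T
  refine cls_bernardi_injective d' ?_
  dsimp only
  rw [cls_bernardi_bernardiAct, hc, hc, cls_bernardi_bernardiAct, add_assoc]

/-- The Bernardi action with fixed initial data. -/
noncomputable abbrev bernardiAddAction (d : D) : AddAction G.Pic0 G.SpanningTree where
  vadd γ T := G.bernardiAct d γ T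
  zero_vadd T := cls_bernardi_injective d <| by
    change G.cls (G.bernardi d (G.bernardiAct d 0 T)) = _
    rw [cls_bernardi_bernardiAct, ZeroMemClass.coe_zero, zero_add]
  add_vadd γ γ' T := cls_bernardi_injective d <| by
    change G.cls (G.bernardi d (G.bernardiAct d (γ + γ') T)) =
      G.cls (G.bernardi d (G.bernardiAct d γ (G.bernardiAct d γ' T)))
    rw [cls_bernardi_bernardiAct, cls_bernardi_bernardiAct, cls_bernardi_bernardiAct,
      AddMemClass.coe_add, add_assoc]

theorem existsUnique_bernardiAct_eq (d : D) (T T' : G.SpanningTree) :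
    ∃! γ : G.Pic0, G.bernardiAct d γ T = T' := by
  have hdeg : ∀ T, degree (G.bernardi d T) = G.genus := fun T =>
    degree_of_isBreakMod (isBreakMod_of_mem_breakDivisors (bernardi_mem_breakDivisors d T))
  refine ⟨⟨G.cls (G.bernardi d T' - G.bernardi d T), _, ?_, rfl⟩, ?_, ?_⟩
  · change degree _ = 0
    rw [map_sub, hdeg, hdeg, sub_self]
  · refine cls_bernardi_injective d ?_
    dsimp only
    rw [cls_bernardi_bernardiAct, ← cls_add, sub_add_cancel]
  · rintro γ rfl
    refine Subtype.ext ?_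
    have h := cls_bernardi_bernardiAct d γ T
    exact eq_sub_of_add_eq h.symm

theorem subsingleton_pic0 [IsEmpty D] : Subsingleton G.Pic0 := by
  have := subsingleton_vert G
  have h0 : ∀ γ : G.Pic0, γ = 0 := by
    rintro ⟨_, F, hF, rfl⟩
    have hF0 : F = 0 := by
      ext v
      have h : ∑ v, F v = 0 := hF
      rwa [Fintype.sum_subsingleton _ v] at h
    subst hF0
    rfl
  exact ⟨fun a b => (h0 a).trans (h0 b).symm⟩

theorem subsingleton_spanningTree [IsEmpty D] : Subsingleton G.SpanningTree := by
  have := isEmpty_edge G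
  exact ⟨fun T T' => Subtype.ext (Subsingleton.elim _ _)⟩

theorem IsPlanar.existsUnique_addAction (hG : G.IsPlanar) :
    ∃! _a : AddAction G.Pic0 G.SpanningTree,
      (∀ (d : D) (γ : G.Pic0) (T : G.SpanningTree), γ +ᵥ T = G.bernardiAct d γ T) ∧
      (∀ T T' : G.SpanningTree, ∃! γ : G.Pic0, γ +ᵥ T = T') := by
  rcases isEmpty_or_nonempty D with hD | ⟨⟨d⟩⟩
  -- Without edges no initial data exist and the condition on `bernardiAct` is vacuous, but the
  -- group and the set of trees are trivial.
  · have := subsingleton_pic0 (G := G)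
    have := subsingleton_spanningTree (G := G)
    refine ⟨{ vadd := fun _ T => T, zero_vadd := fun _ => rfl, add_vadd := fun _ _ _ => rfl },
      ⟨fun d => isEmptyElim d, fun T T' => ⟨0, Subsingleton.elim _ _, fun _ _ =>
        Subsingleton.elim _ _⟩⟩, fun a _ => ?_⟩
    refine AddAction.ext ?_
    ext1 γ
    ext1 T
    exact Subsingleton.elim _ _
  · refine ⟨bernardiAddAction d, ⟨fun d' γ T => ?_, existsUnique_bernardiAct_eq d⟩, ?_⟩
    · exact congrFun (congrFun (hG.bernardiAct_eq d d') γ) T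
    · rintro a ⟨ha, -⟩
      refine AddAction.ext ?_
      ext1 γ
      ext1 T
      exact ha d γ T

end RibbonGraph

theorem theorem5p1 {V E D : Type*} [Fintype V] [Fintype E] [Fintype D] (G : RibbonGraph V E D)
    (hG : G.IsPlanar) :
    (∀ d : D, Set.BijOn (G.bernardi d) Set.univ G.breakDivisors) ∧
    (∀ c ∈ G.PicDeg G.genus, ∃! F, F ∈ G.breakDivisors ∧ G.cls F = c) ∧
    (∀ d d' : D, G.bernardiAct d = G.bernardiAct d') ∧
    Nonempty G.SpanningTree ∧
    ∃! _a : AddAction G.Pic0 G.SpanningTree,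
      (∀ (d : D) (γ : G.Pic0) (T : G.SpanningTree), γ +ᵥ T = G.bernardiAct d γ T) ∧
      (∀ T T' : G.SpanningTree, ∃! γ : G.Pic0, γ +ᵥ T = T') :=
  ⟨RibbonGraph.bijOn_bernardi, fun _ hc => RibbonGraph.existsUnique_breakDivisor hc,
    hG.bernardiAct_eq, RibbonGraph.nonempty_spanningTree, hG.existsUnique_addAction⟩
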